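/- Let $L>0$, $\omega_0>0$, $\alpha\ge 0$, $f\in C^2(\mathbb R)$ and $\omega_1=\omega_0L$. Let $X,V\in C^4(\mathbb R)$ be $L$-periodic, $X>0$, $\int_0^LX=L$, $\int_0^LV=0$, and let $C_1,C_2>0$ and $0<\delta<1$ satisfy $$\Bigl(1+\frac{\alpha}{8\omega_0}\Bigr)\Bigl(2c_1+\frac{C_1}{L}\Bigr)+\frac{2c_2+C_2/L}{4\omega_0}<\delta,\qquad c_1=L\int_0^L|X''|,\quad c_2=L\int_0^L|V''|.$$ For each sufficiently large $N$ let $x_k=x_k^{(N)}:[0,\infty)\to\mathbb R$, $k\in\mathbb Z$, satisfy $x_{k+N}=x_k+L$ and $$\ddot x_k=(\omega_0N)^2(x_{k+1}-2x_k+x_{k-1})-\alpha\dot x_k+f(t),\qquad t\ge0,$$ with $x_0(0)=0$, $x_k(0)<x_{k+1}(0)$ and, for all $k$, $$\Bigl|x_{k+1}(0)-x_k(0)-\tfrac LNX(\tfrac{kL}N)\Bigr|<\frac{C_1}{N^2},\qquad \Bigl|\dot x_{k+1}(0)-\dot x_k(0)-\tfrac LNV(\tfrac{kL}N)\Bigr|<\frac{C_2}{N^2};$$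 assume also that $\dot x^{(N)}_0(0)$ converges to some $v\in\mathbb R$ as $N\to\infty$ (for instance, that it does not depend on $N$). Then the following limits exist as $N\to\infty$, for every $T>0$ uniformly in $t\in[0,T]$ and in $a\in\mathbb R$, respectively $y\in[0,L)$: $$Y(t,a)=\lim x^{(N)}_{k(a,N)}(t),\qquad F(t,y)=\lim\frac1N\#\{0\le k<N:\ x_k^{(N)}(t)\bmod L\in[0,y]\},$$ where $k(a,N)$ is defined by $x^{(N)}_{k(a,N)}(0)\le a<x^{(N)}_{k(a,N)+1}(0)$. For every $t\ge0$ the map $Y(t,\cdot)$ is a strictly increasing bijection of $\mathbb R$ with $Y(t,a+L)=Y(t,a)+L$, and there are functions $n(t,\cdot)$, $u(t,\cdot)$ on the circle $\mathbb R/L\mathbb Z$ with $n(t,y)=\partial_yF(t,y)$ for $y\in[0,L)$ (right derivative at $y=0$) and $\partial_tY(t,a)=u(t,Y(t,a))$ for all $a$. Put $\rho=L\,n$ (the density of the particles, normalised so that $\rho\equiv1$ at equilibrium). For all $t>0$ and all $y$ on the circle, $\rho>0$, $\rho$ and $u$ are differentiable in $t$ and in $y$, and $$\rho_t+(u\rho)_y=0,\qquad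 u_t+uu_y+\alpha u-f=-\frac{\omega_1^2\rho_y}{\rho^3}=\frac1\rho\Bigl(\frac{\omega_1^2}{\rho}\Bigr)_y=-\frac{p_y}{\rho},\qquad p=-\frac{\omega_1^2}{\rho}+C,$$ for every constant $C$. Equivalently, the density $n$ of total mass one satisfies the same equations with $\omega_1$ replaced by $\omega_0$. -/

import Mathlib

open Set Filter Topology

namespace ClosedString

/-- Newton's equations of the closed chain with `N` particles per period `L`, interaction
frequency `ω`, friction `α` and driving force `f`. Here `x k t` is the coordinate and `w k t` the
velocity of particle `k`. Particles are initially ordered on the line, particle `0` starts at the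
origin, and derivatives at `t = 0` are one-sided. -/
structure IsChain (L ω α : ℝ) (f : ℝ → ℝ) (N : ℕ) (x w : ℤ → ℝ → ℝ) : Prop where
  periodic : ∀ k : ℤ, ∀ t : ℝ, 0 ≤ t → x (k + N) t = x k t + L
  origin : x 0 0 = 0
  ordered : ∀ k : ℤ, x k 0 < x (k + 1) 0
  velocity : ∀ k : ℤ, ∀ t : ℝ, 0 ≤ t → HasDerivWithinAt (x k) (w k t) (Ici 0) t
  newton : ∀ k : ℤ, ∀ t : ℝ, 0 ≤ t →
    HasDerivWithinAt (w k)
      (ω ^ 2 * (x (k + 1) t - 2 * x k t + x (k - 1) t) - α * w k t + f t) (Ici 0) t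

/-- The two smooth `L`-periodic profiles: `X` for the gaps, `V` for the velocity increments. -/
structure IsProfile (L : ℝ) (X V : ℝ → ℝ) : Prop where
  smooth_X : ContDiff ℝ 4 X
  smooth_V : ContDiff ℝ 4 V
  periodic_X : Function.Periodic X L
  periodic_V : Function.Periodic V L
  pos_X : ∀ s, 0 < X s
  integral_X : ∫ s in (0 : ℝ)..L, X s = L
  integral_V : ∫ s in (0 : ℝ)..L, V s = 0

/-- The initial data of the `N`-particle chain follow the profiles up to `C₁ / N²`, `C₂ / N²`. -/
def FollowsProfile (L : ℝ) (X V : ℝ → ℝ) (C₁ C₂ : ℝ) (N : ℕ) (x w : ℤ → ℝ → ℝ) : Prop :=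
  ∀ k : ℤ,
    |x (k + 1) 0 - x k 0 - L / N * X (k * L / N)| < C₁ / (N : ℝ) ^ 2 ∧
    |w (k + 1) 0 - w k 0 - L / N * V (k * L / N)| < C₂ / (N : ℝ) ^ 2

/-- `L ∫₀ᴸ |g''|`, the fluctuation constant of a profile. -/
noncomputable def fluctuation (L : ℝ) (g : ℝ → ℝ) : ℝ :=
  L * ∫ s in (0 : ℝ)..L, |iteratedDeriv 2 g s|

/-- The constant `γ` whose smallness excludes collisions. -/
noncomputable def gammaConst (L ω₀ α C₁ C₂ : ℝ) (X V : ℝ → ℝ) : ℝ :=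
  (1 + α / (8 * ω₀)) * (2 * fluctuation L X + C₁ * L⁻¹)
    + (2 * fluctuation L V + C₂ * L⁻¹) / (4 * ω₀)

/-- The index `k` of the particle with `q k ≤ a < q (k + 1)`; see `particleIndex_spec`. -/
noncomputable def particleIndex (q : ℤ → ℝ) (a : ℝ) : ℤ := sSup {k : ℤ | q k ≤ a}

theorem particleIndex_spec {L : ℝ} (hL : 0 < L) {N : ℕ} {q : ℤ → ℝ}
    (hq : ∀ k : ℤ, q k < q (k + 1)) (hp : ∀ k : ℤ, q (k + N) = q k + L) (a : ℝ) :
    q (particleIndex q a) ≤ a ∧ a < q (particleIndex q a + 1) := by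
  have hmono : StrictMono q := strictMono_int_of_lt_succ hq
  have hmul : ∀ m : ℤ, q (m * N) = q 0 + m * L := by
    intro m
    induction m using Int.induction_on with
    | zero => simp
    | succ i ih =>
      have h := hp (i * N)
      rw [ih] at h
      rw [add_mul, one_mul, h]
      push_cast
      ring
    | pred i ih =>
      have h := hp ((-(i : ℤ) - 1) * N)
      have e : (-(i : ℤ) - 1) * N + N = -(i : ℤ) * N := by ring
      rw [e, ih] at h
      push_cast at h ⊢
      linarith
  have hne : {k : ℤ | q k ≤ a}.Nonempty := by
    refine ⟨⌊(a - q 0) / L⌋ * N, ?_⟩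
    have h := Int.floor_le ((a - q 0) / L)
    rw [le_div_iff₀ hL] at h
    rw [mem_ofPred_eq, hmul]
    linarith
  have hbdd : BddAbove {k : ℤ | q k ≤ a} := by
    refine ⟨(⌊(a - q 0) / L⌋ + 1) * N, fun k hk => ?_⟩
    have h := Int.lt_floor_add_one ((a - q 0) / L)
    rw [div_lt_iff₀ hL] at h
    refine (hmono.lt_iff_lt.1 (lt_of_le_of_lt hk ?_)).le
    rw [hmul]
    push_cast
    linarith
  refine ⟨Int.csSup_mem hne hbdd, ?_⟩
  by_contra hcon
  have h := le_csSup hbdd (show particleIndex q a + 1 ∈ {k : ℤ | q k ≤ a} from not_lt.1 hcon)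
  have h' : particleIndex q a + 1 ≤ particleIndex q a := h
  omega

/-- Reduction modulo `L` to `[0, L)`. -/
noncomputable def circleProj (L s : ℝ) : ℝ := L * Int.fract (s / L)

/-- The fraction of the particles `0, …, N - 1` which at time `t` lie in `[0, y]` on the circle. -/
noncomputable def empiricalDistribution (L : ℝ) (N : ℕ) (x : ℤ → ℝ → ℝ) (t y : ℝ) : ℝ :=
  (Nat.card {k : Fin N // circleProj L (x ((k : ℕ) : ℤ) t) ≤ y} : ℝ) / N

/-- `Y t a` is the trajectory of the continuum particle starting at `a`: the limit of the
trajectories of the particles nearest to `a` from the left at time `0`. -/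
def IsLimitFlow (x : ℕ → ℤ → ℝ → ℝ) (Y : ℝ → ℝ → ℝ) : Prop :=
  ∀ T : ℝ, 0 < T →
    TendstoUniformlyOn
      (fun (N : ℕ) (p : ℝ × ℝ) => x N (particleIndex (fun k => x N k 0) p.2) p.1)
      (fun p => Y p.1 p.2) atTop (Icc 0 T ×ˢ univ)

/-- `F t y`, for `y ∈ [0, L)`, is the limit of the empirical distribution functions. -/
def IsLimitDistribution (L : ℝ) (x : ℕ → ℤ → ℝ → ℝ) (F : ℝ → ℝ → ℝ) : Prop :=
  ∀ T : ℝ, 0 < T →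
    TendstoUniformlyOn
      (fun (N : ℕ) (p : ℝ × ℝ) => empiricalDistribution L N (x N) p.1 p.2)
      (fun p => F p.1 p.2) atTop (Icc 0 T ×ˢ Ico 0 L)

/-- The function `n t` on the circle, given as an `L`-periodic function, is the density of the
distribution function `F t` on `[0, L)`. -/
structure IsDensity (L : ℝ) (F n : ℝ → ℝ → ℝ) : Prop where
  periodic : ∀ t : ℝ, 0 ≤ t → Function.Periodic (n t) L
  deriv : ∀ t : ℝ, 0 ≤ t → ∀ y ∈ Ico 0 L, HasDerivWithinAt (F t) (n t y) (Ico 0 L) y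

/-- The function `u t` on the circle, given as an `L`-periodic function, is the velocity at time
`t` of the unique particle of the flow `Y` situated at the given point: `Y t` is a continuous
increasing bijection which descends to the circle, and `∂ₜ Y (t, a) = u (t, Y (t, a))`. -/
structure IsVelocityField (L : ℝ) (Y u : ℝ → ℝ → ℝ) : Prop where
  shift : ∀ t : ℝ, 0 ≤ t → ∀ a : ℝ, Y t (a + L) = Y t a + L
  strictMono : ∀ t : ℝ, 0 ≤ t → StrictMono (Y t)
  surjective : ∀ t : ℝ, 0 ≤ t → Function.Surjective (Y t)
  periodic : ∀ t : ℝ, 0 ≤ t → Function.Periodic (u t) L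
  deriv : ∀ t : ℝ, 0 ≤ t → ∀ a : ℝ,
    HasDerivWithinAt (fun s => Y s a) (u t (Y t a)) (Ici 0) t

/-- The pressure `-κ² / ρ + C`. -/
noncomputable def pressure (κ C ρ : ℝ) : ℝ := -κ ^ 2 / ρ + C

/-- The conservation law and the Euler equation with pressure `p = -κ² / ρ + C`, satisfied by
the positive density `ρ` and the velocity `u` classically at all times `t > 0`. -/
structure SolvesEuler (κ α : ℝ) (f : ℝ → ℝ) (ρ u : ℝ → ℝ → ℝ) : Prop where
  pos : ∀ t y : ℝ, 0 < t → 0 < ρ t y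
  diff_ρ_t : ∀ t y : ℝ, 0 < t → DifferentiableAt ℝ (fun s => ρ s y) t
  diff_ρ_y : ∀ t y : ℝ, 0 < t → DifferentiableAt ℝ (fun η => ρ t η) y
  diff_u_t : ∀ t y : ℝ, 0 < t → DifferentiableAt ℝ (fun s => u s y) t
  diff_u_y : ∀ t y : ℝ, 0 < t → DifferentiableAt ℝ (fun η => u t η) y
  conservation : ∀ t y : ℝ, 0 < t →
    deriv (fun s => ρ s y) t + deriv (fun η => u t η * ρ t η) y = 0
  euler : ∀ t y : ℝ, 0 < t →
    deriv (fun s => u s y) t + u t y * deriv (fun η => u t η) y + α * u t y - f t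
      = -(κ ^ 2 * deriv (fun η => ρ t η) y / ρ t y ^ 3)
  euler' : ∀ t y : ℝ, 0 < t →
    deriv (fun s => u s y) t + u t y * deriv (fun η => u t η) y + α * u t y - f t
      = 1 / ρ t y * deriv (fun η => κ ^ 2 / ρ t η) y
  euler_pressure : ∀ C t y : ℝ, 0 < t →
    deriv (fun s => u s y) t + u t y * deriv (fun η => u t η) y + α * u t y - f t
      = -(deriv (fun η => pressure κ C (ρ t η)) y / ρ t y)

end ClosedString

/-! The interaction is linear, so in Lagrangian coordinates the limit problem is a linear wave
equation. The chain is the method-of-lines discretisation, with mesh `L / N`, of `Φ_tt = ω₁² Φ_ss -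
α Φ_t + f`; here `s = kL/N` labels the particle `k`, and the initial data are `Φ_s = X`, `Φ_ts = V`,
with `Φ` and `Φ_t` at the origin equal to `0` and `v`.

Separation of variables gives `Φ` as a rigid motion plus Fourier series whose time factors are
damped oscillators (`exists_isWave_of_isModeExpansion`, `exists_isContinuumLimit`). Oscillator
energy does not grow for `t ≥ 0`, so the condition on `γ` yields `|Φ_s - 1| ≤ δ < 1` for all such
times: particles never collide, and `Φ t` is an increasing bi-Lipschitz bijection.

The difference between the chain and the samples of `Φ` solves the same chain with a source of size
`O(1/N)`. A discrete energy estimate (`chainEnergy_le`) and a discrete Sobolev inequality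
(`abs_le_of_sum_sq_le`) make it uniformly small on bounded time intervals
(`eventually_abs_chain_sub_le`).

The rest is a change to Eulerian coordinates. With `label` the inverse of `Φ t`, the limits are `Y t
a = Φ t (label Φ 0 a)` and `F t y = (label Φ t y - label Φ t 0) / L`, hence `ρ = 1 / Φ_s` and `u =
Φ_t`, both evaluated at the label. The acceleration of a particle is `Φ_tt`, and the wave equation
turns into the Euler equation because `Φ_s = 1 / ρ` (`solvesEuler`). -/

namespace ClosedString

/-! ### Damped oscillators and their energy -/

/-- The damped harmonic oscillator `c'' = -μ² c - α c'` has solutions on the whole line. -/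
theorem exists_dampedOscillator (μ α a b : ℝ) :
    ∃ c d : ℝ → ℝ, (∀ t, HasDerivAt c (d t) t) ∧
      (∀ t, HasDerivAt d (-μ ^ 2 * c t - α * d t) t) ∧ c 0 = a ∧ d 0 = b := by
  -- The equation is the planar linear system `z' = A z`, solved by `exp (t A)`.
  let A : (ℝ × ℝ) →L[ℝ] (ℝ × ℝ) :=
    (ContinuousLinearMap.snd ℝ ℝ ℝ).prod
      ((-μ ^ 2) • ContinuousLinearMap.fst ℝ ℝ ℝ - α • ContinuousLinearMap.snd ℝ ℝ ℝ)
  let z : ℝ → ℝ × ℝ := fun t => NormedSpace.exp (t • A) (a, b)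
  have hz : ∀ t, HasDerivAt z (A (z t)) t := fun t => by
    have h := (hasDerivAt_exp_smul_const' (𝕂 := ℝ) A t).clm_apply (hasDerivAt_const t (a, b))
    simpa [z] using h
  have hz0 : z 0 = (a, b) := by simp [z]
  refine ⟨fun t => (z t).1, fun t => (z t).2, fun t => ?_, fun t => ?_, by simp [hz0], by simp [hz0]⟩
  · have h : HasDerivAt (fun t => (z t).1) (A (z t)).1 t := (hz t).fst
    simpa [A] using h
  · have h : HasDerivAt (fun t => (z t).2) (A (z t)).2 t := (hz t).snd
    simpa [A] using h

section Energy

variable {μ α : ℝ} {c d : ℝ → ℝ}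

theorem hasDerivAt_oscillatorEnergy (hc : ∀ t, HasDerivAt c (d t) t)
    (hd : ∀ t, HasDerivAt d (-μ ^ 2 * c t - α * d t) t) (t : ℝ) :
    HasDerivAt (fun t => d t ^ 2 + μ ^ 2 * c t ^ 2) (-2 * α * d t ^ 2) t := by
  have h := ((hd t).pow 2).add (((hc t).pow 2).const_mul (μ ^ 2))
  refine HasDerivAt.congr_deriv h ?_
  push_cast
  ring

theorem oscillatorEnergy_le (hα : 0 ≤ α) (hc : ∀ t, HasDerivAt c (d t) t)
    (hd : ∀ t, HasDerivAt d (-μ ^ 2 * c t - α * d t) t) {t : ℝ} (ht : 0 ≤ t) :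
    d t ^ 2 + μ ^ 2 * c t ^ 2 ≤ d 0 ^ 2 + μ ^ 2 * c 0 ^ 2 := by
  have h : Antitone (fun t => d t ^ 2 + μ ^ 2 * c t ^ 2) :=
    antitone_of_hasDerivAt_nonpos (hasDerivAt_oscillatorEnergy hc hd)
      (fun t => by
        have := mul_nonneg hα (sq_nonneg (d t))
        change -2 * α * d t ^ 2 ≤ 0
        linarith)
  exact h ht

/-- Backwards in time friction feeds energy in, but at relative rate at most `2α`. Negative times
matter because the wave is built on the whole time axis, which makes two-sided derivatives available
at `t = 0`. -/
theorem oscillatorEnergy_le_exp (hα : 0 ≤ α) (hc : ∀ t, HasDerivAt c (d t) t)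
    (hd : ∀ t, HasDerivAt d (-μ ^ 2 * c t - α * d t) t) (t : ℝ) :
    d t ^ 2 + μ ^ 2 * c t ^ 2 ≤ Real.exp (2 * α * |t|) * (d 0 ^ 2 + μ ^ 2 * c 0 ^ 2) := by
  rcases le_total 0 t with ht | ht
  · refine (oscillatorEnergy_le hα hc hd ht).trans (le_mul_of_one_le_left (by positivity) ?_)
    exact Real.one_le_exp (by positivity)
  · have h : Monotone (fun t => Real.exp (2 * α * t) * (d t ^ 2 + μ ^ 2 * c t ^ 2)) := by
      refine monotone_of_hasDerivAt_nonneg (fun t =>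
        (((hasDerivAt_id t).const_mul (2 * α)).exp).mul (hasDerivAt_oscillatorEnergy hc hd t))
        (fun t => ?_)
      have h1 : 0 ≤ Real.exp (2 * α * t) * (2 * α * (μ ^ 2 * c t ^ 2)) := by positivity
      change 0 ≤ _ + _
      simp only [id]
      nlinarith
    have h0 := h ht
    simp only [mul_zero, Real.exp_zero, one_mul] at h0
    rw [abs_of_nonpos ht]
    have e : Real.exp (2 * α * -t) * Real.exp (2 * α * t) = 1 := by
      rw [← Real.exp_add]; simp
    calc d t ^ 2 + μ ^ 2 * c t ^ 2
        = Real.exp (2 * α * -t) * (Real.exp (2 * α * t) * (d t ^ 2 + μ ^ 2 * c t ^ 2)) := by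
          rw [← mul_assoc, e, one_mul]
      _ ≤ _ := by gcongr

theorem oscillator_bounds (hμ : 0 < μ) (hα : 0 ≤ α) (hc : ∀ t, HasDerivAt c (d t) t)
    (hd : ∀ t, HasDerivAt d (-μ ^ 2 * c t - α * d t) t) (t : ℝ) :
    |c t| ≤ Real.exp (α * |t|) * (|c 0| + |d 0| / μ) ∧
      |d t| ≤ Real.exp (α * |t|) * (|c 0| + |d 0| / μ) * μ := by
  have h := oscillatorEnergy_le_exp hα hc hd t
  have e : Real.exp (2 * α * |t|) = Real.exp (α * |t|) ^ 2 := by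
    rw [← Real.exp_nat_mul]; push_cast; ring_nf
  set M := Real.exp (α * |t|) * (|c 0| + |d 0| / μ) * μ with hM
  have hM0 : 0 ≤ M := by positivity
  have h2 : d t ^ 2 + μ ^ 2 * c t ^ 2 ≤ M ^ 2 := by
    refine h.trans ?_
    rw [e, hM]
    have : Real.exp (α * |t|) * (|c 0| + |d 0| / μ) * μ
        = Real.exp (α * |t|) * (|c 0| * μ + |d 0|) := by field_simp
    rw [this, mul_pow]
    gcongr
    nlinarith [sq_abs (c 0), sq_abs (d 0), mul_nonneg (mul_nonneg (abs_nonneg (c 0)) hμ.le)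
      (abs_nonneg (d 0))]
  have h3 : |μ * c t| ≤ M := abs_le_of_sq_le_sq (by nlinarith only [h2, sq_nonneg (d t)]) hM0
  have h4 : |d t| ≤ M := abs_le_of_sq_le_sq (by nlinarith only [h2, sq_nonneg (μ * c t)]) hM0
  refine ⟨?_, h4⟩
  rw [abs_mul, abs_of_pos hμ, hM, mul_comm] at h3
  exact le_of_mul_le_mul_right h3 hμ

/-- Without the exponential factor of `oscillator_bounds`: the slope bound must hold uniformly for
all `t ≥ 0`. -/
theorem oscillator_bound_of_nonneg (hμ : 0 < μ) (hα : 0 ≤ α) (hc : ∀ t, HasDerivAt c (d t) t)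
    (hd : ∀ t, HasDerivAt d (-μ ^ 2 * c t - α * d t) t) {t : ℝ} (ht : 0 ≤ t) :
    |c t| ≤ |c 0| + |d 0| / μ := by
  have h := oscillatorEnergy_le hα hc hd ht
  have h3 : |μ * c t| ≤ |c 0| * μ + |d 0| := by
    refine abs_le_of_sq_le_sq ?_ (by positivity)
    nlinarith [sq_abs (c 0), sq_abs (d 0), sq_nonneg (d t),
      mul_nonneg (mul_nonneg (abs_nonneg (c 0)) hμ.le) (abs_nonneg (d 0))]
  rw [abs_mul, abs_of_pos hμ] at h3
  have e : |c 0| + |d 0| / μ = (|c 0| * μ + |d 0|) / μ := by field_simp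
  rw [e, le_div_iff₀ hμ]
  linarith

end Energy

/-! ### Fourier expansion of the profiles -/

section Fourier

open Complex in
/-- The `n`-th exponential of period `L`. -/
noncomputable def wave (L : ℝ) (n : ℤ) (s : ℝ) : ℂ := exp (2 * Real.pi * I * n * s / L)

/-- The factor `2πin/L` by which differentiation acts on `wave L n`. -/
noncomputable def waveSymbol (L : ℝ) (n : ℤ) : ℂ := 2 * Real.pi * Complex.I * n / L

theorem norm_wave (L : ℝ) (n : ℤ) (s : ℝ) : ‖wave L n s‖ = 1 := by
  have : (2 * Real.pi * Complex.I * n * s / L : ℂ) = ((2 * Real.pi * n * s / L : ℝ) : ℂ) * Complex.I := by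
    push_cast; ring
  rw [wave, this, Complex.norm_exp_ofReal_mul_I]

theorem norm_waveSymbol {L : ℝ} (hL : 0 < L) (n : ℤ) :
    ‖waveSymbol L n‖ = 2 * Real.pi * |(n : ℝ)| / L := by
  simp [waveSymbol, abs_of_pos hL, abs_of_pos Real.pi_pos]

theorem hasDerivAt_wave (L : ℝ) (n : ℤ) (s : ℝ) :
    HasDerivAt (wave L n) (waveSymbol L n * wave L n s) s := by
  have h : HasDerivAt (fun s : ℝ => (2 * Real.pi * Complex.I * n * s / L : ℂ)) (waveSymbol L n) s := by
    have := ((Complex.ofRealCLM.hasDerivAt (x := s)).const_mul (2 * Real.pi * Complex.I * n : ℂ)).div_const (L : ℂ)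
    simpa [waveSymbol] using this
  exact h.cexp.congr_deriv (mul_comm _ _)

theorem continuous_wave (L : ℝ) (n : ℤ) : Continuous (wave L n) :=
  continuous_iff_continuousAt.2 fun s => (hasDerivAt_wave L n s).continuousAt

theorem wave_add_period {L : ℝ} (hL : 0 < L) (n : ℤ) (s : ℝ) : wave L n (s + L) = wave L n s := by
  have hL' : (L : ℂ) ≠ 0 := by exact_mod_cast hL.ne'
  rw [wave, wave, Complex.exp_eq_exp_iff_exists_int]
  refine ⟨n, ?_⟩
  push_cast
  field_simp

/-- The Fourier coefficients of a function of period `L`. -/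
noncomputable def coefficient (L : ℝ) (g : ℝ → ℝ) (n : ℤ) : ℂ :=
  1 / L * ∫ s in (0 : ℝ)..L, wave L (-n) s * (g s : ℂ)

theorem norm_coefficient_le {L : ℝ} (hL : 0 < L) (g : ℝ → ℝ) (n : ℤ) :
    ‖coefficient L g n‖ ≤ 1 / L * ∫ s in (0 : ℝ)..L, |g s| := by
  rw [coefficient, norm_mul]
  have h1 : ‖(1 / L : ℂ)‖ = 1 / L := by simp [abs_of_pos hL]
  rw [h1]
  gcongr
  refine (intervalIntegral.norm_integral_le_integral_norm hL.le).trans_eq ?_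
  simp [norm_wave]

/-- Integration by parts; the boundary terms cancel by periodicity. -/
theorem coefficient_deriv {L : ℝ} (hL : 0 < L) {g g' : ℝ → ℝ} (hg : ∀ s, HasDerivAt g (g' s) s)
    (hg' : Continuous g') (hp : Function.Periodic g L) (n : ℤ) :
    coefficient L g' n = waveSymbol L n * coefficient L g n := by
  have hb : wave L (-n) L * (g L : ℂ) - wave L (-n) 0 * (g 0 : ℂ) = 0 := by
    have h1 := wave_add_period hL (-n) 0
    have h2 := hp 0
    rw [zero_add] at h1 h2
    rw [h1, h2, sub_self]
  have hgc : Continuous g := continuous_iff_continuousAt.2 fun s => (hg s).continuousAt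
  have h := intervalIntegral.integral_mul_deriv_eq_deriv_mul (a := 0) (b := L)
    (u := wave L (-n)) (v := fun s => (g s : ℂ)) (u' := fun s => waveSymbol L (-n) * wave L (-n) s)
    (v' := fun s => (g' s : ℂ)) (fun s _ => hasDerivAt_wave L (-n) s) (fun s _ => (hg s).ofReal_comp)
    ((continuous_const.mul (continuous_wave L (-n))).intervalIntegrable _ _)
    ((Complex.continuous_ofReal.comp hg').intervalIntegrable _ _)
  rw [hb, zero_sub] at h
  simp only [mul_assoc] at h
  rw [intervalIntegral.integral_const_mul] at h
  have hs : waveSymbol L (-n) = -waveSymbol L n := by simp [waveSymbol, neg_div]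
  rw [coefficient, coefficient, h, hs]
  ring

theorem hasSum_coefficient {L : ℝ} (hL : 0 < L) {g : ℝ → ℝ} (hg : Continuous g)
    (hp : Function.Periodic g L) (hs : Summable (coefficient L g)) (s : ℝ) :
    HasSum (fun n => coefficient L g n * wave L n s) (g s : ℂ) := by
  have : Fact (0 < L) := ⟨hL⟩
  have hp' : Function.Periodic (fun s => (g s : ℂ)) L := fun s => by simp [hp s]
  have hcont : Continuous (hp'.lift : AddCircle L → ℂ) := by
    refine QuotientAddGroup.isOpenQuotientMap_mk.isQuotientMap.continuous_iff.2 ?_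
    exact Complex.continuous_ofReal.comp hg
  let G : C(AddCircle L, ℂ) := ⟨hp'.lift, hcont⟩
  have hw : ∀ n (s : ℝ), fourier n (s : AddCircle L) = wave L n s := fun n s => fourier_coe_apply
  have hc : ∀ n, fourierCoeff G n = coefficient L g n := fun n => by
    rw [fourierCoeff_eq_intervalIntegral _ n 0, coefficient, zero_add]
    simp only [hw, smul_eq_mul]
    rw [Complex.real_smul]
    push_cast
    rfl
  have h := has_pointwise_sum_fourier_series_of_summable (f := G)
    (by rw [show fourierCoeff G = coefficient L g from funext hc]; exact hs) (s : AddCircle L)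
  simp only [hc, hw, smul_eq_mul] at h
  exact h

/-- The wave number `2π|n|/L` (of the lowest nonconstant mode for `n = 0`). -/
noncomputable def waveNumber (L : ℝ) (n : ℤ) : ℝ := 2 * Real.pi * max 1 |(n : ℝ)| / L

theorem waveNumber_ge {L : ℝ} (hL : 0 < L) (n : ℤ) : 2 * Real.pi / L ≤ waveNumber L n := by
  rw [waveNumber]
  exact div_le_div_of_nonneg_right
    (le_mul_of_one_le_right (by positivity) (le_max_left _ _)) hL.le

theorem waveNumber_pos {L : ℝ} (hL : 0 < L) (n : ℤ) : 0 < waveNumber L n :=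
  lt_of_lt_of_le (by positivity) (waveNumber_ge hL n)

theorem waveNumber_of_ne {L : ℝ} {n : ℤ} (hn : n ≠ 0) :
    waveNumber L n = 2 * Real.pi * |(n : ℝ)| / L := by
  have : (1 : ℝ) ≤ |(n : ℝ)| := by exact_mod_cast Int.one_le_abs hn
  rw [waveNumber, max_eq_right this]

/-- Two copies of `ζ(2) = π²/6`; the term `n = 0` is `1 / 0 = 0`. -/
theorem hasSum_one_div_int_sq : HasSum (fun n : ℤ => 1 / (n : ℝ) ^ 2) (Real.pi ^ 2 / 3) := by
  have h1 := (hasSum_nat_add_iff' (f := fun n : ℕ => 1 / (n : ℝ) ^ 2) 1).2 hasSum_zeta_two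
  have h2 : HasSum (fun n : ℤ => 1 / (n : ℝ) ^ 2) _ :=
    HasSum.of_nat_of_neg_add_one (f := fun n : ℤ => 1 / (n : ℝ) ^ 2)
      (by simpa using hasSum_zeta_two)
      (by
        refine h1.congr_fun ?_
        intro n
        push_cast
        ring)
  convert h2 using 1
  simp
  ring

/-- An expansion of an `L`-periodic function with zero mean in eigenfunctions of the second
derivative, given through the primitives `p n` of the modes `q n`. The mode `n = 0` vanishes. -/
structure IsModeExpansion (L : ℝ) (g : ℝ → ℝ) (p q : ℤ → ℝ → ℝ) (A : ℤ → ℝ) : Prop where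
  deriv_p : ∀ n s, HasDerivAt (p n) (q n s) s
  deriv_q : ∀ n s, HasDerivAt (q n) (-waveNumber L n ^ 2 * p n s) s
  periodic : ∀ n s, p n (s + L) = p n s
  bound_p : ∀ n s, |p n s| ≤ A n / waveNumber L n
  bound_q : ∀ n s, |q n s| ≤ A n
  hasSum : ∀ s, HasSum (fun n => q n s) (g s)
  nonneg : ∀ n, 0 ≤ A n
  summable_sq : Summable fun n => A n * waveNumber L n ^ 2
  summable : Summable A
  tsum_le : ∑' n, A n ≤ fluctuation L g

theorem periodic_of_hasDerivAt {L : ℝ} {g g' : ℝ → ℝ} (hg : ∀ s, HasDerivAt g (g' s) s)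
    (hp : Function.Periodic g L) : Function.Periodic g' L := fun s => by
  have h : HasDerivAt (fun s => g (s + L)) (g' (s + L)) s := (hg (s + L)).comp_add_const s L
  rw [show (fun s => g (s + L)) = g from funext hp] at h
  exact h.unique (hg s)

/-- With `a n` the Fourier coefficients of `g`, the modes are the real parts of `a n * wave L n` and
`A n = ‖a n‖`. Two derivatives of `g` give `A n = O(1/n²)` with a constant explicit enough to bound
the sum by the fluctuation; four derivatives give `A n * waveNumber L n ^ 2 = O(1/n²)`. -/
theorem exists_isModeExpansion {L : ℝ} (hL : 0 < L) {g : ℝ → ℝ} (hg : ContDiff ℝ 4 g)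
    (hp : Function.Periodic g L) (hmean : ∫ s in (0 : ℝ)..L, g s = 0) :
    ∃ p q A, IsModeExpansion L g p q A := by
  have hder : ∀ j : ℕ, j < 4 → ∀ s,
      HasDerivAt (iteratedDeriv j g) (iteratedDeriv (j + 1) g s) s := fun j hj s => by
    rw [iteratedDeriv_succ]
    exact ((hg.differentiable_iteratedDeriv j (by exact_mod_cast hj)) s).hasDerivAt
  have hcont : ∀ j : ℕ, j ≤ 4 → Continuous (iteratedDeriv j g) := fun j hj =>
    hg.continuous_iteratedDeriv j (by exact_mod_cast hj)
  have hper : ∀ j : ℕ, j ≤ 4 → Function.Periodic (iteratedDeriv j g) L := by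
    intro j
    induction j with
    | zero => intro _; simpa using hp
    | succ j ih => intro hj; exact periodic_of_hasDerivAt (hder j (by omega)) (ih (by omega))
  have hcoef : ∀ j : ℕ, j ≤ 4 → ∀ n,
      coefficient L (iteratedDeriv j g) n = waveSymbol L n ^ j * coefficient L g n := by
    intro j
    induction j with
    | zero => intro _ n; simp
    | succ j ih =>
      intro hj n
      rw [coefficient_deriv hL (hder j (by omega)) (hcont _ hj) (hper j (by omega)),
        ih (by omega), pow_succ']
      ring
  set a := coefficient L g with ha
  -- Zero mean removes the constant mode, which has no periodic primitive.
  have ha0 : a 0 = 0 := by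
    have : (fun s => wave L (-0) s * (g s : ℂ)) = fun s => ((g s : ℝ) : ℂ) := by
      funext s; simp [wave]
    rw [ha, coefficient, this, intervalIntegral.integral_ofReal, hmean]
    simp
  have hbound : ∀ j : ℕ, j ≤ 4 → 0 < j → ∀ n, ‖a n‖ ≤
      1 / L * (∫ s in (0 : ℝ)..L, |iteratedDeriv j g s|) / waveNumber L n ^ j := by
    intro j hj hj0 n
    have hint : 0 ≤ ∫ s in (0 : ℝ)..L, |iteratedDeriv j g s| :=
      intervalIntegral.integral_nonneg hL.le fun _ _ => abs_nonneg _
    have hw := waveNumber_pos hL n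
    rcases eq_or_ne n 0 with rfl | hn
    · rw [ha0, norm_zero]; positivity
    · have h := norm_coefficient_le hL (iteratedDeriv j g) n
      rw [hcoef j hj, norm_mul, norm_pow, norm_waveSymbol hL, ← waveNumber_of_ne hn] at h
      rw [le_div_iff₀ (by positivity)]
      linarith
  have hinv : ∀ n, n ≠ 0 → 1 / waveNumber L n ^ 2 = L ^ 2 / (4 * Real.pi ^ 2) * (1 / (n : ℝ) ^ 2) := by
    intro n hn
    have hn' : (n : ℝ) ≠ 0 := by exact_mod_cast hn
    rw [waveNumber_of_ne hn, div_pow, mul_pow, mul_pow, sq_abs]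
    field_simp
    norm_num
  have hA2 : ∀ n, ‖a n‖ ≤ fluctuation L g / (4 * Real.pi ^ 2) * (1 / (n : ℝ) ^ 2) := by
    intro n
    rcases eq_or_ne n 0 with rfl | hn
    · simp [ha0]
    · refine (hbound 2 (by norm_num) (by norm_num) n).trans_eq ?_
      rw [div_eq_mul_one_div, hinv n hn, fluctuation]
      field_simp
  have hsumA : Summable fun n => ‖a n‖ :=
    Summable.of_nonneg_of_le (fun _ => norm_nonneg _) hA2 (hasSum_one_div_int_sq.summable.mul_left _)
  have hre : ∀ z : ℂ, ∀ n s, |(z * wave L n s).re| ≤ ‖z‖ := fun z n s =>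
    (Complex.abs_re_le_norm _).trans (by rw [norm_mul, norm_wave, mul_one])
  have hσ : ∀ n, n ≠ 0 → waveSymbol L n ≠ 0 := fun n hn => by
    rw [← norm_ne_zero_iff, norm_waveSymbol hL, ← waveNumber_of_ne hn]
    exact (waveNumber_pos hL n).ne'
  have hσ2 : ∀ n, n ≠ 0 → waveSymbol L n ^ 2 = -((waveNumber L n : ℝ) : ℂ) ^ 2 := fun n hn => by
    have h : ((|(n : ℝ)| : ℝ) : ℂ) ^ 2 = (n : ℂ) ^ 2 := by
      rw [← Complex.ofReal_pow, sq_abs]; push_cast; rfl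
    rw [waveNumber_of_ne hn, waveSymbol]
    push_cast
    simp only [div_pow, mul_pow, h, Complex.I_sq]
    ring
  have hwd : ∀ (z : ℂ) n s, HasDerivAt (fun s => (z * wave L n s).re)
      ((z * (waveSymbol L n * wave L n s)).re) s := fun z n s => by
    have h := ((hasDerivAt_wave L n s).const_mul z)
    exact Complex.reCLM.hasFDerivAt.comp_hasDerivAt s h
  refine ⟨fun n s => (a n / waveSymbol L n * wave L n s).re, fun n s => (a n * wave L n s).re,
    fun n => ‖a n‖, ?_⟩
  constructor
  · intro n s
    refine (hwd _ n s).congr_deriv ?_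
    rcases eq_or_ne n 0 with rfl | hn
    · simp [ha0]
    · have := hσ n hn
      congr 1
      field_simp
  · intro n s
    refine (hwd _ n s).congr_deriv ?_
    rcases eq_or_ne n 0 with rfl | hn
    · simp [ha0]
    · have h1 := hσ n hn
      have h2 : a n * (waveSymbol L n * wave L n s)
          = ((-waveNumber L n ^ 2 : ℝ) : ℂ) * (a n / waveSymbol L n * wave L n s) := by
        push_cast
        rw [← hσ2 n hn]
        field_simp
      rw [h2, Complex.re_ofReal_mul]
  · intro n s
    simp only [wave_add_period hL]
  · intro n s
    refine (hre _ n s).trans_eq ?_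
    rcases eq_or_ne n 0 with rfl | hn
    · simp [ha0]
    · rw [norm_div, norm_waveSymbol hL, waveNumber_of_ne hn]
  · exact fun n s => hre _ n s
  · intro s
    have h := hasSum_coefficient hL hg.continuous hp hsumA.of_norm s
    simpa using Complex.hasSum_re h
  · exact fun n => norm_nonneg _
  · refine Summable.of_nonneg_of_le (fun n => by positivity) (fun n => ?_)
      (hasSum_one_div_int_sq.summable.mul_left
        (1 / L * (∫ s in (0 : ℝ)..L, |iteratedDeriv 4 g s|) * (L ^ 2 / (4 * Real.pi ^ 2))))
    rcases eq_or_ne n 0 with rfl | hn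
    · simp [ha0]
    · have hw := waveNumber_pos hL n
      rw [mul_assoc, ← hinv n hn]
      refine (mul_le_mul_of_nonneg_right (hbound 4 le_rfl (by norm_num) n) (by positivity)).trans_eq ?_
      field_simp
  · exact hsumA
  · have h := hsumA.tsum_le_tsum hA2 (hasSum_one_div_int_sq.summable.mul_left _)
    rw [tsum_mul_left, hasSum_one_div_int_sq.tsum_eq] at h
    refine h.trans ?_
    have hfl : 0 ≤ fluctuation L g := mul_nonneg hL.le
      (intervalIntegral.integral_nonneg hL.le fun _ _ => abs_nonneg _)
    -- The sharp outcome is a twelfth of the fluctuation; the full fluctuation suffices.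
    have : fluctuation L g / (4 * Real.pi ^ 2) * (Real.pi ^ 2 / 3) = fluctuation L g / 12 := by
      field_simp
      ring
    linarith

end Fourier

/-! ### The limiting wave by separation of variables -/

/-- The total derivative with partial derivatives `a` in time and `b` in space. -/
noncomputable def gradient (a b : ℝ) : ℝ × ℝ →L[ℝ] ℝ :=
  a • ContinuousLinearMap.fst ℝ ℝ ℝ + b • ContinuousLinearMap.snd ℝ ℝ ℝ

@[simp] theorem gradient_apply (a b : ℝ) (z : ℝ × ℝ) : gradient a b z = a * z.1 + b * z.2 := rfl

theorem gradient_add (a b a' b' : ℝ) :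
    gradient a b + gradient a' b' = gradient (a + a') (b + b') := by
  ext <;> simp

theorem norm_gradient_le (a b : ℝ) : ‖gradient a b‖ ≤ |a| + |b| := by
  refine (norm_add_le _ _).trans (add_le_add ?_ ?_)
  · rw [norm_smul, Real.norm_eq_abs]
    exact mul_le_of_le_one_right (abs_nonneg a) (ContinuousLinearMap.norm_fst_le ..)
  · rw [norm_smul, Real.norm_eq_abs]
    exact mul_le_of_le_one_right (abs_nonneg b) (ContinuousLinearMap.norm_snd_le ..)

theorem hasFDerivAt_mul_gradient {c r : ℝ → ℝ} {c' r' t s : ℝ} (hc : HasDerivAt c c' t)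
    (hr : HasDerivAt r r' s) :
    HasFDerivAt (fun z : ℝ × ℝ => c z.1 * r z.2) (gradient (c' * r s) (c t * r')) (t, s) := by
  have h1 : HasFDerivAt (fun z : ℝ × ℝ => c z.1) (c' • ContinuousLinearMap.fst ℝ ℝ ℝ) (t, s) :=
    HasDerivAt.comp_hasFDerivAt (h₂ := c) (t, s) hc hasFDerivAt_fst
  have h2 : HasFDerivAt (fun z : ℝ × ℝ => r z.2) (r' • ContinuousLinearMap.snd ℝ ℝ ℝ) (t, s) :=
    HasDerivAt.comp_hasFDerivAt (h₂ := r) (t, s) hr hasFDerivAt_snd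
  refine (h1.mul h2).congr_fderiv ?_
  ext
  · simp; ring
  · simp

/-- Termwise differentiation on the strip `|t| < T`, which is convex: convergence at the single
point `(0, 0)` and summable majorants of both partial derivatives suffice. -/
theorem hasFDerivAt_tsum_mul {c d r r' : ℤ → ℝ → ℝ} (hc : ∀ n t, HasDerivAt (c n) (d n t) t)
    (hr : ∀ n s, HasDerivAt (r n) (r' n s) s) (h0 : Summable fun n => c n 0 * r n 0)
    {T : ℝ} {a b : ℤ → ℝ} (ha : Summable a) (hb : Summable b)
    (hda : ∀ n t s, |t| < T → |d n t * r n s| ≤ a n)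
    (hcb : ∀ n t s, |t| < T → |c n t * r' n s| ≤ b n) {t : ℝ} (ht : |t| < T) (s : ℝ) :
    HasFDerivAt (fun z : ℝ × ℝ => ∑' n, c n z.1 * r n z.2)
      (gradient (∑' n, d n t * r n s) (∑' n, c n t * r' n s)) (t, s) := by
  have hT : 0 < T := (abs_nonneg t).trans_lt ht
  have h := hasFDerivAt_tsum_of_isPreconnected (𝕜 := ℝ) (u := fun n => a n + b n)
    (s := Ioo (-T) T ×ˢ (univ : Set ℝ))
    (f := fun n (z : ℝ × ℝ) => c n z.1 * r n z.2)
    (f' := fun n z => gradient (d n z.1 * r n z.2) (c n z.1 * r' n z.2)) (x₀ := (0, 0))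
    (x := (t, s)) (ha.add hb) (isOpen_Ioo.prod isOpen_univ)
    ((convex_Ioo _ _).prod convex_univ).isPreconnected
    (fun n z _ => hasFDerivAt_mul_gradient (hc n z.1) (hr n z.2))
    (fun n z hz => (norm_gradient_le _ _).trans
      (add_le_add (hda n _ _ (abs_lt.2 hz.1)) (hcb n _ _ (abs_lt.2 hz.1))))
    ⟨⟨by linarith, hT⟩, mem_univ _⟩ h0 ⟨abs_lt.1 ht, mem_univ _⟩
  refine h.congr_fderiv ?_
  have h1 : Summable fun n => d n t * r n s :=
    Summable.of_norm_bounded ha fun n => hda n t s ht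
  have h2 : Summable fun n => c n t * r' n s :=
    Summable.of_norm_bounded hb fun n => hcb n t s ht
  have e : ∀ n, gradient (d n t * r n s) (c n t * r' n s)
      = (d n t * r n s) • ContinuousLinearMap.fst ℝ ℝ ℝ
        + (c n t * r' n s) • ContinuousLinearMap.snd ℝ ℝ ℝ := fun n => rfl
  simp only [e]
  rw [(h1.smul_const _).tsum_add (h2.smul_const _), h1.tsum_smul_const, h2.tsum_smul_const]
  rfl

theorem abs_sub_le_of_hasDerivAt {g g' : ℝ → ℝ} {K : ℝ} (hg : ∀ s, HasDerivAt g (g' s) s)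
    (hK : ∀ s, |g' s| ≤ K) (x y : ℝ) : |g x - g y| ≤ K * |x - y| :=
  convex_univ.norm_image_sub_le_of_norm_hasDerivWithin_le
    (fun s _ => (hg s).hasDerivWithinAt) (fun s _ => hK s) (mem_univ y) (mem_univ x)

/-- A twice differentiable solution of `Φ_tt = ω² Φ_ss - α Φ_t + f(t)` together with its
derivatives of order at most two. -/
structure IsWave (ω α : ℝ) (f : ℝ → ℝ) (Φ Φt Φs Φtt Φts Φss : ℝ → ℝ → ℝ) : Prop where
  deriv : ∀ t s, HasFDerivAt (fun z : ℝ × ℝ => Φ z.1 z.2) (gradient (Φt t s) (Φs t s)) (t, s)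
  deriv_t : ∀ t s, HasFDerivAt (fun z : ℝ × ℝ => Φt z.1 z.2) (gradient (Φtt t s) (Φts t s)) (t, s)
  deriv_s : ∀ t s, HasFDerivAt (fun z : ℝ × ℝ => Φs z.1 z.2) (gradient (Φts t s) (Φss t s)) (t, s)
  equation : ∀ t s, Φtt t s = ω ^ 2 * Φss t s - α * Φt t s + f t

theorem IsWave.add {ω α : ℝ} {f g : ℝ → ℝ} {Φ Φt Φs Φtt Φts Φss Ψ Ψt Ψs Ψtt Ψts Ψss : ℝ → ℝ → ℝ}
    (h : IsWave ω α f Φ Φt Φs Φtt Φts Φss) (k : IsWave ω α g Ψ Ψt Ψs Ψtt Ψts Ψss) :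
    IsWave ω α (f + g) (Φ + Ψ) (Φt + Ψt) (Φs + Ψs) (Φtt + Ψtt) (Φts + Ψts) (Φss + Ψss) where
  deriv t s := ((h.deriv t s).add (k.deriv t s)).congr_fderiv (gradient_add ..)
  deriv_t t s := ((h.deriv_t t s).add (k.deriv_t t s)).congr_fderiv (gradient_add ..)
  deriv_s t s := ((h.deriv_s t s).add (k.deriv_s t s)).congr_fderiv (gradient_add ..)
  equation t s := by
    simp only [Pi.add_apply, h.equation, k.equation]
    ring

/-- The wave is `∑ c n t * p n s`, where every oscillator `c n` has frequency `ω * waveNumber L n`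
and the same initial values `a`, `b`. As `q n` is the derivative of `p n`, the slope `∑ c n t * q n
s` starts as `a * g` with velocity `b * g`. -/
theorem exists_isWave_of_isModeExpansion {L ω α : ℝ} (hL : 0 < L) (hω : 0 < ω) (hα : 0 ≤ α)
    {g : ℝ → ℝ} {p q : ℤ → ℝ → ℝ} {A : ℤ → ℝ} (h : IsModeExpansion L g p q A) (a b : ℝ) :
    ∃ Ψ Ψt Ψs Ψtt Ψts Ψss : ℝ → ℝ → ℝ, IsWave ω α 0 Ψ Ψt Ψs Ψtt Ψts Ψss ∧
      (∀ t s, Ψ t (s + L) = Ψ t s) ∧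
      (∀ t s, 0 ≤ t → |Ψs t s| ≤ (|a| + |b| * (L / (2 * Real.pi * ω))) * fluctuation L g) ∧
      (∃ K, ∀ t x y, 0 ≤ t → |Ψss t x - Ψss t y| ≤ K * |x - y|) ∧
      (∀ s, Ψs 0 s = a * g s) ∧ ∀ s, Ψts 0 s = b * g s := by
  have hμ := waveNumber_pos hL
  have hlam : ∀ n, 0 < ω * waveNumber L n := fun n => mul_pos hω (hμ n)
  choose c d hc hd hc0 hd0 using fun n : ℤ => exists_dampedOscillator (ω * waveNumber L n) α a b
  -- `D` bounds all amplitudes `|a| + |b| / (ω * waveNumber L n)`, the lowest mode being the worst.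
  set D := |a| + |b| * (L / (2 * Real.pi * ω)) with hD
  have hD0 : 0 ≤ D := by positivity
  have hDn : ∀ n, |c n 0| + |d n 0| / (ω * waveNumber L n) ≤ D := fun n => by
    rw [hc0, hd0, hD, div_eq_mul_one_div]
    refine add_le_add_right (mul_le_mul_of_nonneg_left ?_ (abs_nonneg b)) _
    rw [div_le_div_iff₀ (hlam n) (by positivity)]
    have := mul_le_mul_of_nonneg_left (waveNumber_ge hL n) (mul_pos hL hω).le
    calc 1 * (2 * Real.pi * ω) = L * ω * (2 * Real.pi / L) := by field_simp
      _ ≤ L * ω * waveNumber L n := this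
      _ = _ := by ring
  have hcD : ∀ n t, 0 ≤ t → |c n t| ≤ D := fun n t ht =>
    (oscillator_bound_of_nonneg (hlam n) hα (hc n) (hd n) ht).trans (hDn n)
  have hcM : ∀ T n t, |t| < T → |c n t| ≤ Real.exp (α * T) * D := fun T n t ht => by
    refine (oscillator_bounds (hlam n) hα (hc n) (hd n) t).1.trans ?_
    have := hDn n
    have := hlam n
    gcongr
  have hdM : ∀ T n t, |t| < T → |d n t| ≤ Real.exp (α * T) * D * (ω * waveNumber L n) :=
    fun T n t ht => by
    refine (oscillator_bounds (hlam n) hα (hc n) (hd n) t).2.trans ?_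
    have := hDn n
    have := hlam n
    gcongr
  have hsum1 : Summable fun n => A n * waveNumber L n := by
    refine Summable.of_nonneg_of_le (fun n => mul_nonneg (h.nonneg n) (hμ n).le) (fun n => ?_)
      (h.summable.add h.summable_sq)
    -- Since `2μ ≤ 1 + μ²`, the first moment is controlled by the zeroth and the second.
    nlinarith [h.nonneg n, mul_nonneg (h.nonneg n) (sq_nonneg (waveNumber L n - 1))]
  have hcq : ∀ T n t s, |t| < T → |c n t * q n s| ≤ Real.exp (α * T) * D * A n :=
    fun T n t s ht => by
    rw [abs_mul]
    exact mul_le_mul (hcM T n t ht) (h.bound_q n s) (abs_nonneg _) (by positivity)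
  have hdp : ∀ T n t s, |t| < T → |d n t * p n s| ≤ Real.exp (α * T) * D * ω * A n :=
    fun T n t s ht => by
    have := hμ n
    rw [abs_mul]
    refine (mul_le_mul (hdM T n t ht) (h.bound_p n s) (abs_nonneg _) (by positivity)).trans_eq ?_
    field_simp
  have hdq : ∀ T n t s, |t| < T →
      |d n t * q n s| ≤ Real.exp (α * T) * D * ω * (A n * waveNumber L n) :=
    fun T n t s ht => by
    have := hμ n
    rw [abs_mul]
    refine (mul_le_mul (hdM T n t ht) (h.bound_q n s) (abs_nonneg _) (by positivity)).trans_eq ?_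
    ring
  have hcp' : ∀ T n t s, |t| < T → |c n t * (-waveNumber L n ^ 2 * p n s)| ≤
      Real.exp (α * T) * D * (A n * waveNumber L n) := fun T n t s ht => by
    have := hμ n
    rw [abs_mul, abs_mul, abs_neg, abs_of_pos (pow_pos this 2)]
    refine (mul_le_mul (hcM T n t ht) (mul_le_mul_of_nonneg_left (h.bound_p n s) (by positivity))
      (by positivity) (by positivity)).trans_eq ?_
    field_simp
  have hd'p : ∀ T n t s, |t| < T →
      |(-(ω * waveNumber L n) ^ 2 * c n t - α * d n t) * p n s| ≤
      ω ^ 2 * (Real.exp (α * T) * D * (A n * waveNumber L n))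
        + α * (Real.exp (α * T) * D * ω * A n) := fun T n t s ht => by
    have e : (-(ω * waveNumber L n) ^ 2 * c n t - α * d n t) * p n s
        = ω ^ 2 * (c n t * (-waveNumber L n ^ 2 * p n s)) - α * (d n t * p n s) := by ring
    rw [e]
    refine (abs_sub _ _).trans ?_
    rw [abs_mul, abs_mul α, abs_of_nonneg hα, abs_of_nonneg (sq_nonneg ω)]
    have := hcp' T n t s ht
    have := hdp T n t s ht
    gcongr
  have habs : ∀ t : ℝ, |t| < |t| + 1 := fun t => by linarith
  have hcps : Summable fun n => c n 0 * p n 0 := by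
    refine Summable.of_norm_bounded (g := fun n => D * (L / (2 * Real.pi) * A n))
      ((h.summable.mul_left _).mul_left _) fun n => ?_
    have h1 : A n / waveNumber L n ≤ L / (2 * Real.pi) * A n := by
      rw [div_le_iff₀ (hμ n)]
      have := mul_le_mul_of_nonneg_left (waveNumber_ge hL n)
        (mul_nonneg (show 0 ≤ L / (2 * Real.pi) by positivity) (h.nonneg n))
      refine le_trans (le_of_eq ?_) this
      field_simp
    rw [Real.norm_eq_abs, abs_mul]
    exact mul_le_mul (hcD n 0 le_rfl) ((h.bound_p n 0).trans h1) (abs_nonneg _) hD0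
  have hdps : Summable fun n => d n 0 * p n 0 :=
    Summable.of_norm_bounded (h.summable.mul_left _) fun n => hdp 1 n 0 0 (by simp)
  have hcqs : Summable fun n => c n 0 * q n 0 :=
    Summable.of_norm_bounded (h.summable.mul_left _) fun n => hcq 1 n 0 0 (by simp)
  refine ⟨fun t s => ∑' n, c n t * p n s, fun t s => ∑' n, d n t * p n s,
    fun t s => ∑' n, c n t * q n s,
    fun t s => ∑' n, (-(ω * waveNumber L n) ^ 2 * c n t - α * d n t) * p n s,
    fun t s => ∑' n, d n t * q n s, fun t s => ∑' n, c n t * (-waveNumber L n ^ 2 * p n s),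
    ⟨fun t s => ?_, fun t s => ?_, fun t s => ?_, fun t s => ?_⟩, fun t s => ?_, fun t s ht => ?_,
    ⟨D * ∑' n, A n * waveNumber L n ^ 2, fun t x y ht => ?_⟩, fun s => ?_, fun s => ?_⟩
  · exact hasFDerivAt_tsum_mul hc h.deriv_p hcps (h.summable.mul_left _) (h.summable.mul_left _)
      (hdp (|t| + 1)) (hcq (|t| + 1)) (habs t) s
  · exact hasFDerivAt_tsum_mul hd h.deriv_p hdps
      (((hsum1.mul_left _).mul_left _).add ((h.summable.mul_left _).mul_left _))
      (hsum1.mul_left _) (hd'p (|t| + 1)) (hdq (|t| + 1)) (habs t) s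
  · exact hasFDerivAt_tsum_mul hc h.deriv_q hcqs (hsum1.mul_left _) (hsum1.mul_left _)
      (hdq (|t| + 1)) (hcp' (|t| + 1)) (habs t) s
  · have h1 : Summable fun n => c n t * (-waveNumber L n ^ 2 * p n s) :=
      Summable.of_norm_bounded (hsum1.mul_left _) fun n => hcp' (|t| + 1) n t s (habs t)
    have h2 : Summable fun n => d n t * p n s :=
      Summable.of_norm_bounded (h.summable.mul_left _) fun n => hdp (|t| + 1) n t s (habs t)
    rw [← tsum_mul_left, ← tsum_mul_left, ← (h1.mul_left _).tsum_sub (h2.mul_left _)]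
    simp only [Pi.zero_apply, add_zero]
    exact tsum_congr fun n => by ring
  · simp only [h.periodic]
  · have h1 : ∀ n, ‖c n t * q n s‖ ≤ D * A n := fun n => by
      rw [Real.norm_eq_abs, abs_mul]
      exact mul_le_mul (hcD n t ht) (h.bound_q n s) (abs_nonneg _) hD0
    refine (tsum_of_norm_bounded (h.summable.mul_left D).hasSum h1).trans ?_
    rw [tsum_mul_left]
    exact mul_le_mul_of_nonneg_left h.tsum_le hD0
  · have h1 : ∀ s, Summable fun n => c n t * (-waveNumber L n ^ 2 * p n s) := fun s =>
      Summable.of_norm_bounded (hsum1.mul_left _) fun n => hcp' (|t| + 1) n t s (habs t)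
    rw [← (h1 x).tsum_sub (h1 y)]
    have h2 : ∀ n, ‖c n t * (-waveNumber L n ^ 2 * p n x) - c n t * (-waveNumber L n ^ 2 * p n y)‖
        ≤ D * (A n * waveNumber L n ^ 2) * |x - y| := fun n => by
      have e : c n t * (-waveNumber L n ^ 2 * p n x) - c n t * (-waveNumber L n ^ 2 * p n y)
        = -(c n t * (waveNumber L n ^ 2 * (p n x - p n y))) := by ring
      rw [e, norm_neg, Real.norm_eq_abs, abs_mul, abs_mul, abs_of_nonneg (sq_nonneg (waveNumber L n))]
      have h3 := abs_sub_le_of_hasDerivAt (h.deriv_p n) (h.bound_q n) x y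
      calc |c n t| * (waveNumber L n ^ 2 * |p n x - p n y|)
          ≤ D * (waveNumber L n ^ 2 * (A n * |x - y|)) := by
            have := hcD n t ht
            gcongr
        _ = _ := by ring
    refine (tsum_of_norm_bounded ((h.summable_sq.mul_left D).mul_right _).hasSum h2).trans_eq ?_
    rw [tsum_mul_right, tsum_mul_left]
  · simp only [hc0]
    rw [tsum_mul_left, (h.hasSum s).tsum_eq]
  · simp only [hd0]
    rw [tsum_mul_left, (h.hasSum s).tsum_eq]

/-- The continuum limit of the closed chain: a wave `Φ` whose slope is bounded away from zero. -/
structure IsContinuumLimit (L ω α v θ K : ℝ) (f X V : ℝ → ℝ)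
    (Φ Φt Φs Φtt Φts Φss : ℝ → ℝ → ℝ) : Prop
    extends IsWave ω α f Φ Φt Φs Φtt Φts Φss where
  shift : ∀ t s, Φ t (s + L) = Φ t s + L
  slope : ∀ t s, 0 ≤ t → |Φs t s - 1| ≤ θ
  lipschitz : ∀ t x y, 0 ≤ t → |Φss t x - Φss t y| ≤ K * |x - y|
  origin : Φ 0 0 = 0
  origin_t : Φt 0 0 = v
  initial_s : ∀ s, Φs 0 s = X s
  initial_ts : ∀ s, Φts 0 s = V s

/-- Variation of constants. This rigid motion carries the whole driving force, which does not depend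
on `s`. -/
theorem exists_dampedMotion {α : ℝ} {f : ℝ → ℝ} (hf : Continuous f) (a b : ℝ) :
    ∃ m m' : ℝ → ℝ, (∀ t, HasDerivAt m (m' t) t) ∧ (∀ t, HasDerivAt m' (-α * m' t + f t) t) ∧
      m 0 = a ∧ m' 0 = b := by
  have hg : Continuous fun τ => Real.exp (α * τ) * f τ := by fun_prop
  set m' : ℝ → ℝ := fun t =>
    Real.exp (-α * t) * (b + ∫ τ in (0 : ℝ)..t, Real.exp (α * τ) * f τ) with hm'
  have hd : ∀ t, HasDerivAt m' (-α * m' t + f t) t := fun t => by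
    have h1 : HasDerivAt (fun t => Real.exp (-α * t)) (Real.exp (-α * t) * (-α * 1)) t :=
      ((hasDerivAt_id t).const_mul (-α)).exp
    have h2 := (hg.integral_hasStrictDerivAt 0 t).hasDerivAt.const_add b
    refine (h1.mul h2).congr_deriv ?_
    have e : Real.exp (-α * t) * Real.exp (α * t) = 1 := by rw [← Real.exp_add]; simp
    rw [hm', ← mul_assoc (Real.exp (-α * t)) (Real.exp (α * t)), e]
    ring
  have hc : Continuous m' := continuous_iff_continuousAt.2 fun t => (hd t).continuousAt
  exact ⟨fun t => a + ∫ τ in (0 : ℝ)..t, m' τ, m',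
    fun t => (hc.integral_hasStrictDerivAt 0 t).hasDerivAt.const_add a, hd, by simp, by simp [hm']⟩

/-- `Φ = m t + s + Ψ + Ξ`, where `Ψ` starts with slope `X - 1` at rest, `Ξ` with slope zero and
slope velocity `V`, and `m` absorbs `f` and corrects the values at the origin. -/
theorem exists_isContinuumLimit {L ω₀ ω₁ α C₁ C₂ δ v : ℝ} (hL : 0 < L) (hω₀ : 0 < ω₀)
    (hω₁ : ω₁ = ω₀ * L) (hα : 0 ≤ α) (hC₁ : 0 < C₁) (hC₂ : 0 < C₂) {f X V : ℝ → ℝ}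
    (hf : Continuous f) (hXV : IsProfile L X V) (hγ : gammaConst L ω₀ α C₁ C₂ X V < δ) :
    ∃ K, ∃ Φ Φt Φs Φtt Φts Φss : ℝ → ℝ → ℝ,
      IsContinuumLimit L ω₁ α v δ K f X V Φ Φt Φs Φtt Φts Φss := by
  have hω : 0 < ω₁ := hω₁ ▸ mul_pos hω₀ hL
  have hfl : ∀ g, 0 ≤ fluctuation L g := fun g => mul_nonneg hL.le
      (intervalIntegral.integral_nonneg hL.le fun _ _ => abs_nonneg _)
  have hflX : fluctuation L (fun s => X s - 1) = fluctuation L X := by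
    have h1 : deriv (fun s => X s - 1) = deriv X := funext fun s => deriv_sub_const _
    have h2 : iteratedDeriv 2 (fun s => X s - 1) = iteratedDeriv 2 X := by
      rw [show (2 : ℕ) = 1 + 1 from rfl, iteratedDeriv_succ', h1, ← iteratedDeriv_succ']
    rw [fluctuation, h2, fluctuation]
  have hXint : ∫ s in (0 : ℝ)..L, (X s - 1) = 0 := by
    rw [intervalIntegral.integral_sub (hXV.smooth_X.continuous.intervalIntegrable _ _)
      (continuous_const.intervalIntegrable _ _), hXV.integral_X]
    simp
  obtain ⟨p, q, A, hp⟩ := exists_isModeExpansion hL (hXV.smooth_X.sub contDiff_const)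
    (fun s => by simp [hXV.periodic_X s]) hXint
  obtain ⟨P, Q, B, hP⟩ := exists_isModeExpansion hL hXV.smooth_V hXV.periodic_V hXV.integral_V
  obtain ⟨Ψ, Ψt, Ψs, Ψtt, Ψts, Ψss, w1, per1, b1, ⟨K1, l1⟩, i1, j1⟩ :=
    exists_isWave_of_isModeExpansion hL hω hα hp 1 0
  obtain ⟨Ξ, Ξt, Ξs, Ξtt, Ξts, Ξss, w2, per2, b2, ⟨K2, l2⟩, i2, j2⟩ :=
    exists_isWave_of_isModeExpansion hL hω hα hP 0 1
  obtain ⟨m, m', hm, hm', m0, m0'⟩ := exists_dampedMotion (α := α) hf (-(Ψ 0 0 + Ξ 0 0))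
    (v - (Ψt 0 0 + Ξt 0 0))
  have w3 : IsWave ω₁ α f (fun t s => m t + s) (fun t _ => m' t) (fun _ _ => 1)
      (fun t _ => -α * m' t + f t) (fun _ _ => 0) (fun _ _ => 0) := by
    refine ⟨fun t s => ?_, fun t s => ?_, fun t s => ?_, fun t s => by ring⟩
    · have h1 : HasFDerivAt (fun z : ℝ × ℝ => m z.1) (m' t • ContinuousLinearMap.fst ℝ ℝ ℝ) (t, s) :=
        HasDerivAt.comp_hasFDerivAt (h₂ := m) (t, s) (hm t) hasFDerivAt_fst
      refine (h1.add hasFDerivAt_snd).congr_fderiv ?_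
      ext <;> simp
    · have h1 : HasFDerivAt (fun z : ℝ × ℝ => m' z.1)
          ((-α * m' t + f t) • ContinuousLinearMap.fst ℝ ℝ ℝ) (t, s) :=
        HasDerivAt.comp_hasFDerivAt (h₂ := m') (t, s) (hm' t) hasFDerivAt_fst
      refine h1.congr_fderiv ?_
      ext <;> simp
    · refine (hasFDerivAt_const _ _).congr_fderiv ?_
      ext <;> simp
  refine ⟨K1 + K2, _, _, _, _, _, _, ⟨by simpa using (w3.add w1).add w2, fun t s => ?_,
    fun t s ht => ?_, fun t x y ht => ?_, ?_, ?_, fun s => ?_, fun s => ?_⟩⟩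
  · simp only [Pi.add_apply, per1, per2]
    ring
  · simp only [Pi.add_apply]
    have h1 := abs_le.1 (b1 t s ht)
    have h2 := abs_le.1 (b2 t s ht)
    rw [abs_le]
    rw [hflX] at h1
    -- As `ω₁ = ω₀ L`, the left side is `1 / (2πω₀)`, so the slope deviates from `1` by at most `c₁
    -- + c₂ / (2ω₀)`, which is part of `γ`.
    have h3 : L / (2 * Real.pi * ω₁) ≤ 1 / (2 * ω₀) := by
      rw [hω₁, div_le_div_iff₀ (by positivity) (by positivity)]
      nlinarith [Real.pi_gt_three, mul_pos hω₀ hL]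
    have h4 : L / (2 * Real.pi * ω₁) * fluctuation L V ≤ 1 / (2 * ω₀) * fluctuation L V :=
      mul_le_mul_of_nonneg_right h3 (hfl V)
    have h5 : fluctuation L X + 1 / (2 * ω₀) * fluctuation L V ≤ gammaConst L ω₀ α C₁ C₂ X V := by
      rw [gammaConst]
      have h6 : 0 ≤ C₁ * L⁻¹ := by positivity
      have h7 : 0 ≤ C₂ * L⁻¹ / (4 * ω₀) := by positivity
      have h8 : 0 ≤ α / (8 * ω₀) * (2 * fluctuation L X + C₁ * L⁻¹) := by
        have := hfl X
        positivity
      have h9 : (2 * fluctuation L V + C₂ * L⁻¹) / (4 * ω₀)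
        = 1 / (2 * ω₀) * fluctuation L V + C₂ * L⁻¹ / (4 * ω₀) := by field_simp; ring
      have := hfl X
      linarith
    simp only [abs_one, abs_zero, zero_mul, add_zero, one_mul, zero_add] at h1 h2
    constructor <;> linarith [h1.1, h1.2, h2.1, h2.2]
  · simp only [Pi.add_apply]
    have h1 := abs_le.1 (l1 t x y ht)
    have h2 := abs_le.1 (l2 t x y ht)
    rw [abs_le]
    constructor <;> linarith [h1.1, h1.2, h2.1, h2.2]
  · simp only [Pi.add_apply, m0]
    ring
  · simp only [Pi.add_apply, m0']
    ring
  · simp only [Pi.add_apply, i1, i2]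
    ring
  · simp only [Pi.add_apply, j1, j2]
    ring

/-! ### Energy estimate for the discrete wave equation -/

section Discrete

theorem sum_range_shift {N : ℕ} {e : ℤ → ℝ} (he : ∀ k, e (k + N) = e k) :
    ∑ k ∈ Finset.range N, e ((k : ℤ) + 1) = ∑ k ∈ Finset.range N, e k := by
  have h1 := Finset.sum_range_succ (fun k : ℕ => e k) N
  have h2 := Finset.sum_range_succ' (fun k : ℕ => e k) N
  have h3 := he 0
  rw [zero_add] at h3
  push_cast at h1 h2
  linarith

theorem exists_range_eq_of_periodic {N : ℕ} (hN : 0 < N) {e : ℤ → ℝ} (he : ∀ k, e (k + N) = e k)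
    (k : ℤ) : ∃ j : ℕ, j < N ∧ e k = e j := by
  have hN' : (0 : ℤ) < N := by exact_mod_cast hN
  refine ⟨(k % N).toNat, ?_, ?_⟩
  · have := Int.emod_lt_of_pos k hN'
    omega
  · have hp : Function.Periodic e (N : ℤ) := he
    rw [Int.toNat_of_nonneg (Int.emod_nonneg _ hN'.ne')]
    have h := hp.sub_zsmul_eq (k / N) (x := k)
    rw [← h, smul_eq_mul, Int.emod_def, mul_comm]

/-- Discrete Sobolev inequality: by averaging, some index has `|e j| ≤ ε`, and by Cauchy–Schwarz the
total variation over a period is at most `ε / ω`. -/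
theorem abs_le_of_sum_sq_le {N : ℕ} (hN : 0 < N) {e : ℤ → ℝ} (he : ∀ k, e (k + N) = e k)
    {ε ω : ℝ} (hε : 0 ≤ ε) (hω : 0 < ω) (h1 : ∑ k ∈ Finset.range N, e k ^ 2 ≤ N * ε ^ 2)
    (h2 : ∑ k ∈ Finset.range N, (ω * N) ^ 2 * (e ((k : ℤ) + 1) - e k) ^ 2 ≤ N * ε ^ 2) (k : ℤ) :
    |e k| ≤ (1 + 1 / ω) * ε := by
  have hN' : (0 : ℝ) < N := by exact_mod_cast hN
  obtain ⟨j, hj, hej⟩ : ∃ j ∈ Finset.range N, e j ^ 2 ≤ ε ^ 2 := by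
    refine Finset.exists_le_of_sum_le (Finset.nonempty_range_iff.2 hN.ne') ?_
    simpa using h1
  have hej' : |e j| ≤ ε := abs_le_of_sq_le_sq hej hε
  obtain ⟨i, hi, hki⟩ := exists_range_eq_of_periodic hN he k
  rw [hki]
  set S := ∑ k ∈ Finset.range N, |e ((k : ℤ) + 1) - e k| with hS
  have hS0 : 0 ≤ S := Finset.sum_nonneg fun _ _ => abs_nonneg _
  have hSle : S ≤ 1 / ω * ε := by
    have h3 : S ^ 2 ≤ N * ∑ k ∈ Finset.range N, (e ((k : ℤ) + 1) - e k) ^ 2 := by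
      have := sq_sum_le_card_mul_sum_sq (s := Finset.range N)
        (f := fun k : ℕ => |e ((k : ℤ) + 1) - e k|)
      simpa using this
    rw [← Finset.mul_sum] at h2
    refine (abs_of_nonneg hS0).symm.trans_le (abs_le_of_sq_le_sq ?_ (by positivity))
    have h4 : ω ^ 2 * S ^ 2 ≤ ε ^ 2 := by
      have h5 := mul_le_mul_of_nonneg_left h3 (sq_nonneg ω)
      have h6 : N * (ω ^ 2 * S ^ 2) ≤ N * ε ^ 2 := by
        refine le_trans (le_trans (mul_le_mul_of_nonneg_left h5 hN'.le) (le_of_eq ?_)) h2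
        ring
      exact le_of_mul_le_mul_left h6 hN'
    rw [mul_pow, div_pow, one_pow, one_div, inv_mul_eq_div, le_div_iff₀ (by positivity)]
    linarith
  have hdist : ∀ a b : ℕ, a ≤ b → b < N → |e a - e b| ≤ S := fun a b hab hb => by
    have := dist_le_Ico_sum_dist (fun k : ℕ => e k) hab
    rw [Real.dist_eq] at this
    refine this.trans (le_trans (Finset.sum_le_sum_of_subset_of_nonneg (t := Finset.range N)
      (fun k hk => ?_) fun _ _ _ => dist_nonneg) (le_of_eq ?_))
    · rw [Finset.mem_Ico] at hk
      exact Finset.mem_range.2 (by omega)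
    · rw [hS]
      refine Finset.sum_congr rfl fun k _ => ?_
      rw [dist_comm, Real.dist_eq]
      push_cast
      rfl
  have hij : |e i - e j| ≤ S := by
    rcases le_total i j with h | h
    · exact hdist i j h (Finset.mem_range.1 hj)
    · rw [abs_sub_comm]
      exact hdist j i h hi
  have := abs_sub_abs_le_abs_sub (e i) (e j)
  linarith

/-- The energy of a discrete wave, augmented by the square of its amplitude. -/
noncomputable def chainEnergy (ω : ℝ) (N : ℕ) (e d : ℤ → ℝ → ℝ) (t : ℝ) : ℝ :=
  ∑ k ∈ Finset.range N, (e k t ^ 2 + d k t ^ 2 + ω ^ 2 * (e ((k : ℤ) + 1) t - e k t) ^ 2)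

/-- Elastic terms cancel by summation by parts and friction only helps, so `E' ≤ 2E + N R²`, and
Gronwall applies. The amplitude squares in `chainEnergy` are needed because the mechanical energy
does not see translations. -/
theorem chainEnergy_le {ω α R T : ℝ} {N : ℕ} {e d r : ℤ → ℝ → ℝ} (hα : 0 ≤ α)
    (he : ∀ k t, 0 ≤ t → e (k + N) t = e k t) (hd : ∀ k t, 0 ≤ t → d (k + N) t = d k t)
    (hed : ∀ k t, 0 ≤ t → HasDerivWithinAt (e k) (d k t) (Ici 0) t)
    (hdd : ∀ k t, 0 ≤ t → HasDerivWithinAt (d k)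
      (ω ^ 2 * (e (k + 1) t - 2 * e k t + e (k - 1) t) - α * d k t + r k t) (Ici 0) t)
    (hr : ∀ k t, 0 ≤ t → |r k t| ≤ R) {t : ℝ} (ht : t ∈ Icc 0 T) :
    chainEnergy ω N e d t ≤ Real.exp (2 * T) * (chainEnergy ω N e d 0 + N * R ^ 2) := by
  set E' : ℝ → ℝ := fun t => ∑ k ∈ Finset.range N, (2 * e k t * d k t
    + 2 * d k t * (ω ^ 2 * (e ((k : ℤ) + 1) t - 2 * e k t + e ((k : ℤ) - 1) t) - α * d k t + r k t)
    + ω ^ 2 * (2 * (e ((k : ℤ) + 1) t - e k t) * (d ((k : ℤ) + 1) t - d k t))) with hE'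
  have hder : ∀ t, 0 ≤ t → HasDerivWithinAt (chainEnergy ω N e d) (E' t) (Ici 0) t := fun t ht => by
    refine HasDerivWithinAt.fun_sum fun k _ => ?_
    have h1 := (hed k t ht).pow 2
    have h2 := (hdd k t ht).pow 2
    have h3 := (((hed (k + 1) t ht).sub (hed k t ht)).pow 2).const_mul (ω ^ 2)
    refine ((h1.add h2).add h3).congr_deriv ?_
    simp
  have hle : ∀ t, 0 ≤ t → E' t ≤ 2 * chainEnergy ω N e d t + N * R ^ 2 := fun t ht => by
    -- The elastic contributions add up to `2ω² ∑ (a (k + 1) - a k)`, which vanishes by periodicity.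
    set a : ℤ → ℝ := fun k => d k t * (e k t - e (k - 1) t) with ha
    have hshift := sum_range_shift (N := N) (e := a) (fun k => by
      have : k + (N : ℤ) - 1 = k - 1 + N := by ring
      rw [ha]
      simp only [this, he _ t ht, hd _ t ht])
    have hE : E' t = ∑ k ∈ Finset.range N, (2 * e k t * d k t - 2 * α * d k t ^ 2
        + 2 * d k t * r k t) + 2 * ω ^ 2 * (∑ k ∈ Finset.range N, a ((k : ℤ) + 1)
          - ∑ k ∈ Finset.range N, a k) := by
      rw [← Finset.sum_sub_distrib, Finset.mul_sum, ← Finset.sum_add_distrib]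
      refine Finset.sum_congr rfl fun k _ => ?_
      simp only [ha, add_sub_cancel_right]
      ring
    rw [hE, hshift, sub_self, mul_zero, add_zero, chainEnergy, Finset.mul_sum]
    have hc : (N : ℝ) * R ^ 2 = ∑ k ∈ Finset.range N, R ^ 2 := by simp
    rw [hc, ← Finset.sum_add_distrib]
    refine Finset.sum_le_sum fun k _ => ?_
    have h1 : r k t ^ 2 ≤ R ^ 2 := by
      rw [← sq_abs]
      exact pow_le_pow_left₀ (abs_nonneg _) (hr k t ht) 2
    nlinarith [sq_nonneg (e k t - d k t), sq_nonneg (d k t - r k t), sq_nonneg (e k t),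
      mul_nonneg hα (sq_nonneg (d k t)), sq_nonneg (ω * (e ((k : ℤ) + 1) t - e k t))]
  have hmul : ∀ t, 0 ≤ t → HasDerivWithinAt
      (fun t => Real.exp (-2 * t) * (chainEnergy ω N e d t + N * R ^ 2))
      (Real.exp (-2 * t) * (-2 * 1) * (chainEnergy ω N e d t + N * R ^ 2)
        + Real.exp (-2 * t) * E' t) (Ici 0) t := fun t ht =>
    (((hasDerivAt_id t).const_mul (-2)).exp.hasDerivWithinAt).mul ((hder t ht).add_const _)
  have hanti : AntitoneOn (fun t => Real.exp (-2 * t) * (chainEnergy ω N e d t + N * R ^ 2))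
      (Ici 0) := by
    refine antitoneOn_of_hasDerivWithinAt_nonpos (convex_Ici 0)
      (fun t ht => (hmul t ht).continuousWithinAt)
      (fun t ht => (hmul t (interior_subset ht)).mono interior_subset) fun t ht => ?_
    have h1 := hle t (interior_subset ht)
    have h2 := Real.exp_pos (-2 * t)
    have h3 : 0 ≤ (N : ℝ) * R ^ 2 := by positivity
    nlinarith
  have h0 := hanti (mem_Ici.2 le_rfl) (mem_Ici.2 ht.1) ht.1
  simp only [mul_zero, Real.exp_zero, one_mul] at h0
  have hE0 : 0 ≤ chainEnergy ω N e d 0 := Finset.sum_nonneg fun _ _ => by positivity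
  have h3 : 0 ≤ (N : ℝ) * R ^ 2 := by positivity
  have e1 : Real.exp (2 * t) * Real.exp (-2 * t) = 1 := by rw [← Real.exp_add]; simp
  calc chainEnergy ω N e d t ≤ chainEnergy ω N e d t + N * R ^ 2 := by linarith
    _ = Real.exp (2 * t) * (Real.exp (-2 * t) * (chainEnergy ω N e d t + N * R ^ 2)) := by
      rw [← mul_assoc, e1, one_mul]
    _ ≤ Real.exp (2 * t) * (chainEnergy ω N e d 0 + N * R ^ 2) := by gcongr
    _ ≤ _ := by
      have := ht.2
      gcongr

end Discrete

/-! ### Consistency of the finite differences -/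

section Taylor

variable {φ φ' φ'' : ℝ → ℝ} {K : ℝ}

theorem abs_le_mul_of_hasDerivAt {g g' : ℝ → ℝ} {h C : ℝ} (hg : ∀ s, HasDerivAt g (g' s) s)
    (h0 : g 0 = 0) (hC : ∀ s ∈ Icc 0 h, |g' s| ≤ C) {s : ℝ} (hs : s ∈ Icc 0 h) :
    |g s| ≤ C * h := by
  have hh : 0 ≤ h := hs.1.trans hs.2
  have h1 := (convex_Icc 0 h).norm_image_sub_le_of_norm_hasDerivWithin_le
    (fun s _ => (hg s).hasDerivWithinAt) hC (left_mem_Icc.2 hh) hs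
  rw [h0, sub_zero, sub_zero, Real.norm_eq_abs, Real.norm_eq_abs, abs_of_nonneg hs.1] at h1
  have hC0 : 0 ≤ C := (abs_nonneg _).trans (hC 0 (left_mem_Icc.2 hh))
  exact h1.trans (mul_le_mul_of_nonneg_left hs.2 hC0)

theorem abs_increment_sub_le (h1 : ∀ s, HasDerivAt φ (φ' s) s)
    (hK : ∀ x y, |φ' x - φ' y| ≤ K * |x - y|) (s : ℝ) {h : ℝ} (hh : 0 ≤ h) :
    |φ (s + h) - φ s - h * φ' s| ≤ K * h ^ 2 := by
  have hK0 : 0 ≤ K := by simpa using (abs_nonneg _).trans (hK 1 0)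
  have hd : ∀ η, HasDerivAt (fun η => φ (s + η) - φ s - η * φ' s) (φ' (s + η) - φ' s) η := fun η => by
    have := (((h1 (s + η)).comp_const_add s η).sub_const (φ s)).sub
      ((hasDerivAt_id η).mul_const (φ' s))
    refine this.congr_deriv ?_
    simp
  refine (abs_le_mul_of_hasDerivAt (C := K * h) hd (by simp) (fun η hη => ?_)
    (right_mem_Icc.2 hh)).trans_eq (by ring)
  refine (hK _ _).trans ?_
  rw [add_sub_cancel_left, abs_of_nonneg hη.1]
  exact mul_le_mul_of_nonneg_left hη.2 hK0

/-- Two applications of the mean value inequality, with `φ''` merely Lipschitz. The order `h³` is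
enough: multiplied by `(ω₀ N)²` it leaves a source of size `O(1/N)`. -/
theorem abs_secondDifference_sub_le (h1 : ∀ s, HasDerivAt φ (φ' s) s)
    (h2 : ∀ s, HasDerivAt φ' (φ'' s) s) (hK : ∀ x y, |φ'' x - φ'' y| ≤ K * |x - y|) (s : ℝ)
    {h : ℝ} (hh : 0 ≤ h) :
    |φ (s + h) - 2 * φ s + φ (s - h) - h ^ 2 * φ'' s| ≤ 2 * K * h ^ 3 := by
  have hK0 : 0 ≤ K := by simpa using (abs_nonneg _).trans (hK 1 0)
  have hd : ∀ η, HasDerivAt (fun η => φ (s + η) - 2 * φ s + φ (s - η) - η ^ 2 * φ'' s)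
      (φ' (s + η) - φ' (s - η) - 2 * η * φ'' s) η := fun η => by
    have := ((((h1 (s + η)).comp_const_add s η).sub_const (2 * φ s)).add
      ((h1 (s - η)).comp_const_sub s η)).sub (((hasDerivAt_id η).pow 2).mul_const (φ'' s))
    refine this.congr_deriv ?_
    simp
    ring
  have hd2 : ∀ η, HasDerivAt (fun η => φ' (s + η) - φ' (s - η) - 2 * η * φ'' s)
      (φ'' (s + η) + φ'' (s - η) - 2 * φ'' s) η := fun η => by
    have := (((h2 (s + η)).comp_const_add s η).sub
      ((h2 (s - η)).comp_const_sub s η)).sub (((hasDerivAt_id η).const_mul 2).mul_const (φ'' s))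
    refine this.congr_deriv ?_
    simp
  refine (abs_le_mul_of_hasDerivAt (C := 2 * K * h * h) hd (by simp; ring) (fun η hη => ?_)
    (right_mem_Icc.2 hh)).trans_eq (by ring)
  refine abs_le_mul_of_hasDerivAt (C := 2 * K * h) hd2 (by simp) (fun ξ hξ => ?_) hη
  have a1 := hK (s + ξ) s
  have a2 := hK (s - ξ) s
  have e : φ'' (s + ξ) + φ'' (s - ξ) - 2 * φ'' s = (φ'' (s + ξ) - φ'' s) + (φ'' (s - ξ) - φ'' s) := by
    ring
  rw [add_sub_cancel_left, abs_of_nonneg hξ.1] at a1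
  rw [sub_sub_cancel_left, abs_neg, abs_of_nonneg hξ.1] at a2
  rw [e]
  refine (abs_add_le _ _).trans ?_
  have := mul_le_mul_of_nonneg_left hξ.2 hK0
  linarith

end Taylor

/-! ### Convergence of the chains to the wave -/

theorem exists_lipschitz_of_periodic {L : ℝ} (hL : 0 < L) {g : ℝ → ℝ} (hg : ContDiff ℝ 4 g)
    (hp : Function.Periodic g L) : ∃ K, ∀ x y, |g x - g y| ≤ K * |x - y| := by
  have hd : ∀ s, HasDerivAt g (deriv g s) s := fun s =>
    (hg.differentiable (by norm_num) s).hasDerivAt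
  have hc : Continuous (deriv g) := hg.continuous_deriv (by norm_num)
  obtain ⟨K, hK⟩ := ((periodic_of_hasDerivAt hd hp).isBounded_of_continuous hL.ne' hc).exists_norm_le
  exact ⟨K, abs_sub_le_of_hasDerivAt hd fun s => hK _ (mem_range_self s)⟩

theorem IsChain.periodic_velocity {L ω α : ℝ} {f : ℝ → ℝ} {N : ℕ} {x w : ℤ → ℝ → ℝ}
    (h : IsChain L ω α f N x w) (k : ℤ) {t : ℝ} (ht : 0 ≤ t) : w (k + N) t = w k t := by
  have h1 : HasDerivWithinAt (x (k + N)) (w k t) (Ici 0) t :=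
    ((h.velocity k t ht).add_const L).congr (fun s hs => h.periodic k s hs) (h.periodic k t ht)
  exact (uniqueDiffOn_Ici (0 : ℝ) t ht).eq_deriv _ (h.velocity (k + N) t ht) h1

theorem hasDerivAt_fst_of_gradient {g : ℝ → ℝ → ℝ} {a b t s : ℝ}
    (h : HasFDerivAt (fun z : ℝ × ℝ => g z.1 z.2) (gradient a b) (t, s)) :
    HasDerivAt (fun t => g t s) a t := by
  have := HasFDerivAt.comp_hasDerivAt (f := fun t => (t, s)) t h
    ((hasDerivAt_id t).prodMk (hasDerivAt_const t s))
  refine this.congr_deriv ?_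
  simp

theorem hasDerivAt_snd_of_gradient {g : ℝ → ℝ → ℝ} {a b t s : ℝ}
    (h : HasFDerivAt (fun z : ℝ × ℝ => g z.1 z.2) (gradient a b) (t, s)) :
    HasDerivAt (fun s => g t s) b s := by
  have := HasFDerivAt.comp_hasDerivAt (f := fun s => (t, s)) s h
    ((hasDerivAt_const s t).prodMk (hasDerivAt_id s))
  refine this.congr_deriv ?_
  simp

theorem abs_le_of_increment_le {e : ℤ → ℝ} {b c : ℝ} {N : ℕ} (h0 : |e 0| ≤ b) (hc : 0 ≤ c)
    (h : ∀ k, |e (k + 1) - e k| ≤ c / N ^ 2) {k : ℕ} (hk : k < N) : |e k| ≤ b + c / N := by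
  have hN : (0 : ℝ) < N := by exact_mod_cast (Nat.zero_le k).trans_lt hk
  have h1 : ∀ j : ℕ, |e j| ≤ b + j * (c / N ^ 2) := by
    intro j
    induction j with
    | zero => simpa using h0
    | succ j ih =>
      have h2 := abs_sub_abs_le_abs_sub (e ((j : ℤ) + 1)) (e j)
      have h3 := h j
      push_cast
      linarith
  refine (h1 k).trans ?_
  have h4 : (k : ℝ) * (c / N ^ 2) ≤ N * (c / N ^ 2) := by
    have : (k : ℝ) ≤ N := by exact_mod_cast hk.le
    gcongr
  have h5 : (N : ℝ) * (c / N ^ 2) = c / N := by field_simp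
  linarith

/-- The bound for the distance between a chain of `N` particles and its continuum limit. -/
noncomputable def chainError (ω₀ T c₁ c₂ c₃ N η : ℝ) : ℝ :=
  (1 + 1 / ω₀) * √(Real.exp (2 * T) *
    ((c₁ / N) ^ 2 + (η + c₂ / N) ^ 2 + (ω₀ * (c₁ / N)) ^ 2 + (c₃ / N) ^ 2))

/-- The error `e` solves the chain equations with the truncation error `r` as source. Its initial
increments are `O(1/N²)`, so over one period `e` itself and the scaled differences `ω₀ N (e (k + 1)
- e k)` are `O(1/N)`, while the velocity errors also contain the offset `|w 0 0 - v|`. The energy is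
thus `N` times a small quantity, as `abs_le_of_sum_sq_le` requires. -/
theorem abs_chain_sub_le {L ω₀ ω₁ α v θ K C₁ C₂ M₁ M₂ T : ℝ} (hL : 0 < L) (hω₀ : 0 < ω₀)
    (hω₁ : ω₁ = ω₀ * L) (hα : 0 ≤ α) (hC₁ : 0 < C₁) (hC₂ : 0 < C₂) {f X V : ℝ → ℝ}
    {Φ Φt Φs Φtt Φts Φss : ℝ → ℝ → ℝ}
    (hΦ : IsContinuumLimit L ω₁ α v θ K f X V Φ Φt Φs Φtt Φts Φss)
    (hX : ∀ a b, |X a - X b| ≤ M₁ * |a - b|) (hV : ∀ a b, |V a - V b| ≤ M₂ * |a - b|)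
    {N : ℕ} (hN : 0 < N) {x w : ℤ → ℝ → ℝ} (hx : IsChain L (ω₀ * N) α f N x w)
    (hi : FollowsProfile L X V C₁ C₂ N x w) (k : ℤ) {t : ℝ} (ht : t ∈ Icc 0 T) :
    |x k t - Φ t (k * L / N)| ≤ chainError ω₀ T (C₁ + M₁ * L ^ 2) (C₂ + M₂ * L ^ 2)
      (2 * K * ω₀ ^ 2 * L ^ 3) N |w 0 0 - v| := by
  have hN' : (0 : ℝ) < N := by exact_mod_cast hN
  have hM₁ : 0 ≤ M₁ := by simpa using (abs_nonneg _).trans (hX 1 0)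
  have hM₂ : 0 ≤ M₂ := by simpa using (abs_nonneg _).trans (hV 1 0)
  set c₁ := C₁ + M₁ * L ^ 2 with hc₁
  set c₂ := C₂ + M₂ * L ^ 2 with hc₂
  have hc₁0 : 0 ≤ c₁ := by positivity
  have hc₂0 : 0 ≤ c₂ := by positivity
  set h := L / N with hh
  have hh0 : 0 < h := by positivity
  have hs : ∀ k : ℤ, ((k + 1 : ℤ) : ℝ) * L / N = k * L / N + h := fun k => by
    rw [hh]; push_cast; ring
  have hs' : ∀ k : ℤ, ((k - 1 : ℤ) : ℝ) * L / N = k * L / N - h := fun k => by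
    rw [hh]; push_cast; ring
  have hsN : ∀ k : ℤ, ((k + N : ℤ) : ℝ) * L / N = k * L / N + L := fun k => by
    push_cast; field_simp
  set e : ℤ → ℝ → ℝ := fun k t => x k t - Φ t (k * L / N) with he
  set d : ℤ → ℝ → ℝ := fun k t => w k t - Φt t (k * L / N) with hd
  set r : ℤ → ℝ → ℝ := fun k t => (ω₀ * N) ^ 2 * (Φ t (k * L / N + h) - 2 * Φ t (k * L / N)
    + Φ t (k * L / N - h) - h ^ 2 * Φss t (k * L / N)) with hr
  have hpt : ∀ t s, HasDerivAt (fun t => Φ t s) (Φt t s) t := fun t s =>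
    hasDerivAt_fst_of_gradient (hΦ.deriv t s)
  have hptt : ∀ t s, HasDerivAt (fun t => Φt t s) (Φtt t s) t := fun t s =>
    hasDerivAt_fst_of_gradient (hΦ.deriv_t t s)
  have hps : ∀ t s, HasDerivAt (Φ t) (Φs t s) s := fun t s =>
    hasDerivAt_snd_of_gradient (hΦ.deriv t s)
  have hpts : ∀ t s, HasDerivAt (Φt t) (Φts t s) s := fun t s =>
    hasDerivAt_snd_of_gradient (hΦ.deriv_t t s)
  have hpss : ∀ t s, HasDerivAt (Φs t) (Φss t s) s := fun t s =>
    hasDerivAt_snd_of_gradient (hΦ.deriv_s t s)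
  have hper : ∀ k t, 0 ≤ t → e (k + N) t = e k t := fun k t ht => by
    simp only [he, hsN, hΦ.shift, hx.periodic k t ht]
    ring
  have hshift_t : ∀ t s, Φt t (s + L) = Φt t s := fun t s => by
    have h1 := hpt t (s + L)
    simp only [hΦ.shift] at h1
    exact h1.unique ((hpt t s).add_const L)
  have hperd : ∀ k t, 0 ≤ t → d (k + N) t = d k t := fun k t ht => by
    simp only [hd, hsN, hshift_t, hx.periodic_velocity k ht]
  have hed : ∀ k t, 0 ≤ t → HasDerivWithinAt (e k) (d k t) (Ici 0) t := fun k t ht =>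
    (hx.velocity k t ht).sub (hpt t _).hasDerivWithinAt
  have hdd : ∀ k t, 0 ≤ t → HasDerivWithinAt (d k)
      ((ω₀ * N) ^ 2 * (e (k + 1) t - 2 * e k t + e (k - 1) t) - α * d k t + r k t) (Ici 0) t :=
    fun k t ht => by
    refine ((hx.newton k t ht).sub (hptt t _).hasDerivWithinAt).congr_deriv ?_
    have e1 : (ω₀ * N) ^ 2 * h ^ 2 = ω₁ ^ 2 := by rw [hh, hω₁]; field_simp
    simp only [he, hd, hr, hs, hs', hΦ.equation, ← e1]
    ring
  have hrR : ∀ k t, 0 ≤ t → |r k t| ≤ 2 * K * ω₀ ^ 2 * L ^ 3 / N := fun k t ht => by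
    have h1 := abs_secondDifference_sub_le (hps t) (hpss t) (fun a b => hΦ.lipschitz t a b ht)
      (k * L / N) hh0.le
    rw [hr]
    simp only
    rw [abs_mul, abs_of_pos (by positivity : 0 < (ω₀ * N) ^ 2)]
    refine (mul_le_mul_of_nonneg_left h1 (by positivity)).trans_eq ?_
    rw [hh]
    field_simp
  have hinc : ∀ k, |e (k + 1) 0 - e k 0| ≤ c₁ / N ^ 2 := fun k => by
    have h1 := abs_increment_sub_le (hps 0) (fun a b => by simpa only [hΦ.initial_s] using hX a b)
      (k * L / N) hh0.le
    have h2 := (hi k).1.le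
    rw [hΦ.initial_s] at h1
    have e1 : e (k + 1) 0 - e k 0 = (x (k + 1) 0 - x k 0 - L / N * X (k * L / N))
        - (Φ 0 (k * L / N + h) - Φ 0 (k * L / N) - h * X (k * L / N)) := by
      simp only [he, hs]; ring
    rw [e1]
    refine (abs_sub _ _).trans ((add_le_add h2 h1).trans_eq ?_)
    rw [hh, hc₁]
    field_simp
  have hincd : ∀ k, |d (k + 1) 0 - d k 0| ≤ c₂ / N ^ 2 := fun k => by
    have h1 := abs_increment_sub_le (hpts 0) (fun a b => by simpa only [hΦ.initial_ts] using hV a b)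
      (k * L / N) hh0.le
    have h2 := (hi k).2.le
    rw [hΦ.initial_ts] at h1
    have e1 : d (k + 1) 0 - d k 0 = (w (k + 1) 0 - w k 0 - L / N * V (k * L / N))
        - (Φt 0 (k * L / N + h) - Φt 0 (k * L / N) - h * V (k * L / N)) := by
      simp only [hd, hs]; ring
    rw [e1]
    refine (abs_sub _ _).trans ((add_le_add h2 h1).trans_eq ?_)
    rw [hh, hc₂]
    field_simp
  have he0 : ∀ j : ℕ, j < N → |e j 0| ≤ 0 + c₁ / N := fun j hj =>
    abs_le_of_increment_le (e := fun k => e k 0) (by simp [he, hx.origin, hΦ.origin]) hc₁0 hinc hj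
  have hd0 : ∀ j : ℕ, j < N → |d j 0| ≤ |w 0 0 - v| + c₂ / N := fun j hj =>
    abs_le_of_increment_le (e := fun k => d k 0) (by simp [hd, hΦ.origin_t]) hc₂0 hincd hj
  have hE0 : chainEnergy (ω₀ * N) N e d 0 ≤
      N * ((c₁ / N) ^ 2 + (|w 0 0 - v| + c₂ / N) ^ 2 + (ω₀ * (c₁ / N)) ^ 2) := by
    rw [chainEnergy]
    refine (Finset.sum_le_card_nsmul _ _ _ fun j hj => ?_).trans_eq (by
      rw [Finset.card_range, nsmul_eq_mul])
    have hj' := Finset.mem_range.1 hj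
    have h1 := he0 j hj'
    rw [zero_add] at h1
    have h2 := hd0 j hj'
    have h3 : |ω₀ * N * (e ((j : ℤ) + 1) 0 - e j 0)| ≤ ω₀ * (c₁ / N) := by
      rw [abs_mul, abs_of_pos (by positivity : 0 < ω₀ * N)]
      refine (mul_le_mul_of_nonneg_left (hinc j) (by positivity)).trans_eq ?_
      field_simp
    rw [← mul_pow]
    exact add_le_add (add_le_add (sq_le_sq' (abs_le.1 h1).1 (abs_le.1 h1).2)
      (sq_le_sq' (abs_le.1 h2).1 (abs_le.1 h2).2)) (sq_le_sq' (abs_le.1 h3).1 (abs_le.1 h3).2)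
  have hE := chainEnergy_le hα hper hperd hed hdd hrR ht
  set G := Real.exp (2 * T) * ((c₁ / N) ^ 2 + (|w 0 0 - v| + c₂ / N) ^ 2 + (ω₀ * (c₁ / N)) ^ 2
    + (2 * K * ω₀ ^ 2 * L ^ 3 / N) ^ 2) with hG
  have hG0 : 0 ≤ G := by positivity
  have hEG : chainEnergy (ω₀ * N) N e d t ≤ N * √G ^ 2 := by
    rw [Real.sq_sqrt hG0]
    refine hE.trans ((mul_le_mul_of_nonneg_left (add_le_add_left hE0 _)
      (Real.exp_pos _).le).trans_eq ?_)
    rw [hG]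
    ring
  refine abs_le_of_sum_sq_le hN (e := fun k => e k t) (fun k => hper k t ht.1) (Real.sqrt_nonneg G)
    hω₀ (le_trans (Finset.sum_le_sum fun k _ => ?_) hEG)
    (le_trans (Finset.sum_le_sum fun k _ => ?_) hEG) k
  · have h1 := sq_nonneg (d k t)
    have h2 : 0 ≤ (ω₀ * N) ^ 2 * (e ((k : ℤ) + 1) t - e k t) ^ 2 := by positivity
    linarith
  · have h1 := sq_nonneg (d k t)
    have h2 := sq_nonneg (e k t)
    linarith

theorem tendsto_chainError (ω₀ T c₁ c₂ c₃ : ℝ) {η : ℕ → ℝ} (hη : Tendsto η atTop (𝓝 0)) :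
    Tendsto (fun N : ℕ => chainError ω₀ T c₁ c₂ c₃ N (η N)) atTop (𝓝 0) := by
  have hc : ∀ c : ℝ, Tendsto (fun N : ℕ => c / (N : ℝ)) atTop (𝓝 0) :=
    fun c => tendsto_const_div_atTop_nhds_zero_nat c
  have h := (((((((hc c₁).pow 2).add ((hη.add (hc c₂)).pow 2)).add
    (((hc c₁).const_mul ω₀).pow 2)).add ((hc c₃).pow 2)).const_mul
      (Real.exp (2 * T))).sqrt).const_mul (1 + 1 / ω₀)
  simpa [chainError] using h

/-- On bounded time intervals the chains converge uniformly to their continuum limit. -/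
theorem eventually_abs_chain_sub_le {L ω₀ ω₁ α v θ K C₁ C₂ : ℝ} (hL : 0 < L) (hω₀ : 0 < ω₀)
    (hω₁ : ω₁ = ω₀ * L) (hα : 0 ≤ α) (hC₁ : 0 < C₁) (hC₂ : 0 < C₂) {f X V : ℝ → ℝ}
    (hXV : IsProfile L X V) {Φ Φt Φs Φtt Φts Φss : ℝ → ℝ → ℝ}
    (hΦ : IsContinuumLimit L ω₁ α v θ K f X V Φ Φt Φs Φtt Φts Φss)
    {x w : ℕ → ℤ → ℝ → ℝ} (hchain : ∀ᶠ N : ℕ in atTop, IsChain L (ω₀ * N) α f N (x N) (w N))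
    (hinit : ∀ᶠ N : ℕ in atTop, FollowsProfile L X V C₁ C₂ N (x N) (w N))
    (hv : Tendsto (fun N : ℕ => w N 0 0) atTop (𝓝 v)) (T : ℝ) {ε : ℝ} (hε : 0 < ε) :
    ∀ᶠ N : ℕ in atTop, ∀ k : ℤ, ∀ t ∈ Icc 0 T, |x N k t - Φ t (k * L / N)| ≤ ε := by
  obtain ⟨M₁, hX⟩ := exists_lipschitz_of_periodic hL hXV.smooth_X hXV.periodic_X
  obtain ⟨M₂, hV⟩ := exists_lipschitz_of_periodic hL hXV.smooth_V hXV.periodic_V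
  have hη : Tendsto (fun N : ℕ => |w N 0 0 - v|) atTop (𝓝 0) := by
    simpa using (hv.sub_const v).abs
  filter_upwards [hchain, hinit, eventually_gt_atTop 0,
    (tendsto_chainError ω₀ T (C₁ + M₁ * L ^ 2) (C₂ + M₂ * L ^ 2) (2 * K * ω₀ ^ 2 * L ^ 3)
      hη).eventually (ge_mem_nhds hε)] with N h1 h2 h3 h4 k t ht
  exact (abs_chain_sub_le hL hω₀ hω₁ hα hC₁ hC₂ hΦ hX hV h3 h1 h2 k ht).trans h4

/-! ### From Lagrangian to Eulerian coordinates -/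

/-- The label of the particle situated at `y` at time `t`. -/
noncomputable def label (Φ : ℝ → ℝ → ℝ) (t y : ℝ) : ℝ := Function.invFun (Φ t) y

namespace IsContinuumLimit

variable {L ω α v θ K : ℝ} {f X V : ℝ → ℝ} {Φ Φt Φs Φtt Φts Φss : ℝ → ℝ → ℝ}
  (h : IsContinuumLimit L ω α v θ K f X V Φ Φt Φs Φtt Φts Φss)

include h

theorem hasDerivAt_time (t s : ℝ) : HasDerivAt (fun t => Φ t s) (Φt t s) t :=
  hasDerivAt_fst_of_gradient (h.deriv t s)

theorem hasDerivAt_space (t s : ℝ) : HasDerivAt (Φ t) (Φs t s) s :=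
  hasDerivAt_snd_of_gradient (h.deriv t s)

theorem shift_t (t s : ℝ) : Φt t (s + L) = Φt t s := by
  have h1 := h.hasDerivAt_time t (s + L)
  simp only [h.shift] at h1
  exact h1.unique ((h.hasDerivAt_time t s).add_const L)

theorem shift_s (t s : ℝ) : Φs t (s + L) = Φs t s := by
  have h1 := (h.hasDerivAt_space t (s + L)).comp_add_const s L
  simp only [h.shift] at h1
  exact h1.unique ((h.hasDerivAt_space t s).add_const L)

/-- `Φ t` minus the identity is `θ`-Lipschitz; for `θ < 1` this makes `Φ t` bi-Lipschitz and
increasing. -/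
theorem abs_displacement_sub_le {t : ℝ} (ht : 0 ≤ t) (a b : ℝ) :
    |Φ t a - Φ t b - (a - b)| ≤ θ * |a - b| := by
  have h1 := abs_sub_le_of_hasDerivAt (fun s => (h.hasDerivAt_space t s).sub (hasDerivAt_id s))
    (fun s => h.slope t s ht) a b
  convert h1 using 2
  simp
  ring

theorem le_sub {t a b : ℝ} (ht : 0 ≤ t) (hab : a ≤ b) : (1 - θ) * (b - a) ≤ Φ t b - Φ t a := by
  have h1 := (abs_le.1 (h.abs_displacement_sub_le ht b a)).1
  rw [abs_of_nonneg (sub_nonneg.2 hab)] at h1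
  linarith

theorem abs_sub_le (hθ : θ < 1) {t : ℝ} (ht : 0 ≤ t) (a b : ℝ) :
    |Φ t a - Φ t b| ≤ 2 * |a - b| := by
  have h1 := h.abs_displacement_sub_le ht a b
  have h2 := abs_sub_abs_le_abs_sub (Φ t a - Φ t b) (a - b)
  nlinarith [abs_nonneg (a - b)]

theorem abs_sub_ge {t : ℝ} (ht : 0 ≤ t) (a b : ℝ) :
    (1 - θ) * |a - b| ≤ |Φ t a - Φ t b| := by
  have h1 := h.abs_displacement_sub_le ht a b
  have h2 := abs_sub_abs_le_abs_sub (a - b) (Φ t a - Φ t b)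
  rw [abs_sub_comm (a - b)] at h2
  linarith

theorem strictMono (hθ : θ < 1) {t : ℝ} (ht : 0 ≤ t) : StrictMono (Φ t) := fun a b hab => by
  have h1 := h.le_sub ht hab.le
  nlinarith [mul_pos (sub_pos.2 hθ) (sub_pos.2 hab)]

theorem slope_pos (hθ : θ < 1) {t : ℝ} (ht : 0 ≤ t) (s : ℝ) : 0 < Φs t s := by
  have := (abs_le.1 (h.slope t s ht)).1
  linarith

theorem surjective (hθ : θ < 1) {t : ℝ} (ht : 0 ≤ t) : Function.Surjective (Φ t) := by
  have hc : Continuous (Φ t) :=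
    continuous_iff_continuousAt.2 fun s => (h.hasDerivAt_space t s).continuousAt
  have hθ' : 0 < 1 - θ := sub_pos.2 hθ
  refine hc.surjective ?_ ?_
  · refine tendsto_atTop_mono' _ ?_
      (tendsto_atTop_add_const_right _ (Φ t 0) (tendsto_id.const_mul_atTop hθ'))
    filter_upwards [eventually_ge_atTop 0] with s hs
    have := h.le_sub ht hs
    simp only [sub_zero, id] at this ⊢
    linarith
  · refine tendsto_atBot_mono' _ ?_
      (tendsto_atBot_add_const_right _ (Φ t 0) (tendsto_id.const_mul_atBot hθ'))
    filter_upwards [eventually_le_atBot 0] with s hs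
    have := h.le_sub ht hs
    simp only [id]
    linarith

theorem apply_label (hθ : θ < 1) {t : ℝ} (ht : 0 ≤ t) (y : ℝ) : Φ t (label Φ t y) = y :=
  Function.invFun_eq (h.surjective hθ ht y)

theorem label_apply (hθ : θ < 1) {t : ℝ} (ht : 0 ≤ t) (s : ℝ) : label Φ t (Φ t s) = s :=
  Function.leftInverse_invFun (h.strictMono hθ ht).injective s

theorem label_add (hθ : θ < 1) {t : ℝ} (ht : 0 ≤ t) (y : ℝ) :
    label Φ t (y + L) = label Φ t y + L := by
  apply (h.strictMono hθ ht).injective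
  rw [h.shift, h.apply_label hθ ht, h.apply_label hθ ht]

theorem label_strictMono (hθ : θ < 1) {t : ℝ} (ht : 0 ≤ t) : StrictMono (label Φ t) :=
  fun a b hab => by
  rwa [← (h.strictMono hθ ht).lt_iff_lt, h.apply_label hθ ht, h.apply_label hθ ht]

theorem hasDerivAt_label_space (hθ : θ < 1) {t : ℝ} (ht : 0 ≤ t) (y : ℝ) :
    HasDerivAt (label Φ t) (Φs t (label Φ t y))⁻¹ y := by
  refine HasDerivAt.of_local_left_inverse ?_ (h.hasDerivAt_space t _) (h.slope_pos hθ ht _).ne'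
    (Eventually.of_forall fun y => h.apply_label hθ ht y)
  refine ((h.label_strictMono hθ ht).monotone.continuous_of_surjective fun s => ?_).continuousAt
  exact ⟨Φ t s, h.label_apply hθ ht s⟩

/-- By the lower Lipschitz bound, `(1 - θ) |label Φ z.1 z.2 - s| ≤ |z.2 - Φ z.1 s|`, which tends to
`0`. Strict positivity of `t` keeps nearby times in the range of that bound. -/
theorem continuousAt_label (hθ : θ < 1) {t : ℝ} (ht : 0 < t) (y : ℝ) :
    ContinuousAt (fun z : ℝ × ℝ => label Φ z.1 z.2) (t, y) := by
  have hθ' : 0 < 1 - θ := sub_pos.2 hθ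
  set s := label Φ t y with hs
  have hcont : Tendsto (fun z : ℝ × ℝ => |z.2 - Φ z.1 s| / (1 - θ)) (𝓝 (t, y)) (𝓝 0) := by
    have h1 : ContinuousAt (fun z : ℝ × ℝ => Φ z.1 s) (t, y) :=
      ContinuousAt.comp (f := Prod.fst) (g := fun t => Φ t s)
        (h.hasDerivAt_time t s).continuousAt continuousAt_fst
    have h2 : ContinuousAt (fun z : ℝ × ℝ => |z.2 - Φ z.1 s| / (1 - θ)) (t, y) :=
      ((continuousAt_snd.sub h1).abs).div_const _
    have h3 := h2.tendsto
    simpa [hs, h.apply_label hθ ht.le] using h3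
  refine tendsto_iff_dist_tendsto_zero.2 (squeeze_zero' (Eventually.of_forall fun _ => dist_nonneg)
    ?_ hcont)
  have hpos : ∀ᶠ z : ℝ × ℝ in 𝓝 (t, y), 0 < z.1 :=
    continuousAt_fst.eventually (lt_mem_nhds ht)
  filter_upwards [hpos] with z hz
  have h1 := h.abs_sub_ge hz.le (label Φ z.1 z.2) s
  rw [h.apply_label hθ hz.le] at h1
  rw [Real.dist_eq, le_div_iff₀ hθ']
  linarith

/-- Inverse function rule for `(t, s) ↦ (t, Φ t s)`, whose derivative is triangular with diagonal
`1`, `Φs`. -/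
theorem hasFDerivAt_label (hθ : θ < 1) {t : ℝ} (ht : 0 < t) (y : ℝ) :
    HasFDerivAt (fun z : ℝ × ℝ => label Φ z.1 z.2)
      (gradient (-(Φt t (label Φ t y) / Φs t (label Φ t y))) (Φs t (label Φ t y))⁻¹) (t, y) := by
  set s := label Φ t y with hs
  have hP := (h.slope_pos hθ ht.le s).ne'
  let e : (ℝ × ℝ) ≃L[ℝ] (ℝ × ℝ) := (ContinuousLinearEquiv.refl ℝ ℝ).skewProd
    (ContinuousLinearEquiv.unitsEquivAut ℝ (Units.mk0 (Φs t s) hP))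
    (Φt t s • ContinuousLinearMap.id ℝ ℝ)
  have hG : HasFDerivAt (fun z : ℝ × ℝ => (z.1, Φ z.1 z.2)) (e : ℝ × ℝ →L[ℝ] ℝ × ℝ) (t, s) := by
    refine (hasFDerivAt_fst.prodMk (h.deriv t s)).congr_fderiv ?_
    ext <;> simp [e]
  have hinv := HasFDerivAt.of_local_left_inverse (g := fun z : ℝ × ℝ => (z.1, label Φ z.1 z.2))
    (a := (t, y)) (f' := e) (continuousAt_fst.prodMk (h.continuousAt_label hθ ht y)) hG (by
      have hpos : ∀ᶠ z : ℝ × ℝ in 𝓝 (t, y), 0 < z.1 :=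
        continuousAt_fst.eventually (lt_mem_nhds ht)
      filter_upwards [hpos] with z hz
      simp only [h.apply_label hθ hz.le])
  refine hinv.snd.congr_fderiv ?_
  ext <;> simp [e]
  field_simp

/-- Derivatives of a quantity carried by the particles with respect to time and position. -/
theorem hasDerivAt_comp_label (hθ : θ < 1) {g : ℝ → ℝ → ℝ} {t y a b : ℝ} (ht : 0 < t)
    (hg : HasFDerivAt (fun z : ℝ × ℝ => g z.1 z.2) (gradient a b) (t, label Φ t y)) :
    HasDerivAt (fun t => g t (label Φ t y))
        (a - b * (Φt t (label Φ t y) / Φs t (label Φ t y))) t ∧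
      HasDerivAt (fun y => g t (label Φ t y)) (b * (Φs t (label Φ t y))⁻¹) y := by
  have h1 := HasFDerivAt.comp (g := fun z : ℝ × ℝ => g z.1 z.2)
    (f := fun z : ℝ × ℝ => (z.1, label Φ z.1 z.2)) (t, y) hg
    (hasFDerivAt_fst.prodMk (h.hasFDerivAt_label hθ ht y))
  have h2 : HasFDerivAt (fun z : ℝ × ℝ => g z.1 (label Φ z.1 z.2))
      (gradient (a - b * (Φt t (label Φ t y) / Φs t (label Φ t y)))
        (b * (Φs t (label Φ t y))⁻¹)) (t, y) := by
    refine h1.congr_fderiv ?_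
    ext <;> simp
    ring
  exact ⟨hasDerivAt_fst_of_gradient (g := fun t y => g t (label Φ t y)) h2,
    hasDerivAt_snd_of_gradient (g := fun t y => g t (label Φ t y)) h2⟩

theorem isVelocityField (hθ : θ < 1) :
    IsVelocityField L (fun t a => Φ t (label Φ 0 a)) (fun t y => Φt t (label Φ t y)) where
  shift t _ a := by rw [h.label_add hθ le_rfl, h.shift]
  strictMono t ht := (h.strictMono hθ ht).comp (h.label_strictMono hθ le_rfl)
  surjective t ht := (h.surjective hθ ht).comp fun s => ⟨Φ 0 s, h.label_apply hθ le_rfl s⟩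
  periodic t ht y := by
    beta_reduce
    rw [h.label_add hθ ht, h.shift_t]
  deriv t ht a := by
    simp only [h.label_apply hθ ht]
    exact (h.hasDerivAt_time t _).hasDerivWithinAt

theorem isDensity (hθ : θ < 1) :
    IsDensity L (fun t y => (label Φ t y - label Φ t 0) / L)
      (fun t y => L⁻¹ / Φs t (label Φ t y)) where
  periodic t ht y := by
    beta_reduce
    rw [h.label_add hθ ht, h.shift_s]
  deriv t ht y _ := by
    refine (((h.hasDerivAt_label_space hθ ht y).sub_const _).div_const L).hasDerivWithinAt.congr_deriv ?_
    ring

/-- The scale `c` treats both normalisations at once: `c = 1` for `ρ` with `κ = ω₁`, and `c = L⁻¹`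
for `n` with `κ = ω₀`. -/
theorem solvesEuler (hθ : θ < 1) {c κ : ℝ} (hc : 0 < c) (hκ : κ = ω * c) :
    SolvesEuler κ α f (fun t y => c / Φs t (label Φ t y)) (fun t y => Φt t (label Φ t y)) := by
  have hq : ∀ t y, 0 < t → 0 < Φs t (label Φ t y) := fun t y ht => h.slope_pos hθ ht.le _
  have hqd := fun t y (ht : 0 < t) => h.hasDerivAt_comp_label hθ (y := y) ht (h.deriv_s t _)
  have hud := fun t y (ht : 0 < t) => h.hasDerivAt_comp_label hθ (y := y) ht (h.deriv_t t _)
  have hρt := fun t y (ht : 0 < t) => (hasDerivAt_const t c).div (hqd t y ht).1 (hq t y ht).ne'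
  have hρy := fun t y (ht : 0 < t) => (hasDerivAt_const y c).div (hqd t y ht).2 (hq t y ht).ne'
  have hρ : ∀ t y, 0 < t → c / Φs t (label Φ t y) ≠ 0 := fun t y ht => (div_pos hc (hq t y ht)).ne'
  -- The convective derivative of `u` is `Φtt` at the label, since the contributions of the moving
  -- label cancel.
  have hacc : ∀ t y, 0 < t → deriv (fun s => Φt s (label Φ s y)) t
      + Φt t (label Φ t y) * deriv (fun η => Φt t (label Φ t η)) y
      + α * Φt t (label Φ t y) - f t = ω ^ 2 * Φss t (label Φ t y) := fun t y ht => by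
    rw [(hud t y ht).1.deriv, (hud t y ht).2.deriv, h.equation]
    ring
  have hinv : ∀ a t y, 0 < t → HasDerivAt (fun η => a / (c / Φs t (label Φ t η)))
      (a / c * (Φss t (label Φ t y) * (Φs t (label Φ t y))⁻¹)) y := fun a t y ht => by
    refine ((hqd t y ht).2.const_mul (a / c)).congr_of_eventuallyEq (Eventually.of_forall fun η => ?_)
    simp only
    field_simp
  constructor
  · exact fun t y ht => div_pos hc (hq t y ht)
  · exact fun t y ht => (hρt t y ht).differentiableAt
  · exact fun t y ht => (hρy t y ht).differentiableAt
  · exact fun t y ht => (hud t y ht).1.differentiableAt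
  · exact fun t y ht => (hud t y ht).2.differentiableAt
  · intro t y ht
    have h1 := (hρt t y ht).deriv
    have h2 := ((hud t y ht).2.mul (hρy t y ht)).deriv
    have := (hq t y ht).ne'
    refine (congrArg₂ (· + ·) h1 h2).trans ?_
    simp only [Pi.div_apply]
    field_simp
    ring
  · intro t y ht
    rw [hacc t y ht]
    have h1 := (hρy t y ht).deriv
    have := (hq t y ht).ne'
    rw [hκ, show deriv (fun η => c / Φs t (label Φ t η)) y = _ from h1]
    field_simp
    ring
  · intro t y ht
    have := (hq t y ht).ne'
    rw [hacc t y ht, (hinv (κ ^ 2) t y ht).deriv, hκ]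
    field_simp
  · intro C t y ht
    have := (hq t y ht).ne'
    rw [hacc t y ht]
    simp only [pressure]
    rw [((hinv (-κ ^ 2) t y ht).add_const C).deriv, hκ]
    field_simp

end IsContinuumLimit

/-! ### Counting particles -/

section Counting

theorem card_filter_le_le {N : ℕ} {B : ℝ} (hB : 0 ≤ B) :
    ((Finset.range N).filter fun k : ℕ => (k : ℝ) ≤ B).card ≤ B + 1 := by
  have h1 : (Finset.range N).filter (fun k : ℕ => (k : ℝ) ≤ B) ⊆ Finset.range (⌊B⌋₊ + 1) :=
    fun k hk => Finset.mem_range.2 (Nat.lt_succ_of_le (Nat.le_floor (Finset.mem_filter.1 hk).2))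
  have h2 := Finset.card_le_card h1
  rw [Finset.card_range] at h2
  have h3 := Nat.floor_le hB
  have h4 : (((Finset.range N).filter fun k : ℕ => (k : ℝ) ≤ B).card : ℝ) ≤ (⌊B⌋₊ + 1 : ℕ) := by
    exact_mod_cast h2
  push_cast at h4
  linarith

theorem card_filter_ge_le {N : ℕ} {B : ℝ} (hB : B ≤ N) :
    ((Finset.range N).filter fun k : ℕ => B ≤ (k : ℝ)).card ≤ N - B := by
  have h1 : (Finset.range N).filter (fun k : ℕ => B ≤ (k : ℝ)) ⊆ Finset.Ico ⌈B⌉₊ N :=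
    fun k hk => Finset.mem_Ico.2 ⟨Nat.ceil_le.2 (Finset.mem_filter.1 hk).2,
      Finset.mem_range.1 (Finset.mem_filter.1 hk).1⟩
  have h2 := Finset.card_le_card h1
  rw [Nat.card_Ico] at h2
  have h3 := Nat.le_ceil B
  have h4 : (((Finset.range N).filter fun k : ℕ => B ≤ (k : ℝ)).card : ℝ) ≤ (N - ⌈B⌉₊ : ℕ) := by
    exact_mod_cast h2
  rw [Nat.cast_sub (Nat.ceil_le.2 hB)] at h4
  linarith

-- Any `N` consecutive indices give the same count, so the window may start at the particle whose
-- label is nearest above that of the origin.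
open Classical in
theorem card_filter_shift {N : ℕ} {P : ℤ → Prop} (hP : ∀ k, P (k + N) ↔ P k) (j : ℤ) :
    ((Finset.range N).filter fun k : ℕ => P (k + j)).card
      = ((Finset.range N).filter fun k : ℕ => P k).card := by
  have hone : ∀ Q : ℤ → Prop, (∀ k, Q (k + N) ↔ Q k) →
      ((Finset.range N).filter fun k : ℕ => Q (k + 1)).card
        = ((Finset.range N).filter fun k : ℕ => Q k).card := fun Q hQ => by
    have h := sum_range_shift (N := N) (e := fun k => if Q k then 1 else 0) (fun k => by simp [hQ])
    simpa using h
  have hPj : ∀ j k : ℤ, P (k + N + j) ↔ P (k + j) := fun j k => by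
    rw [add_right_comm, hP]
  induction j using Int.induction_on with
  | zero => simp
  | succ i ih =>
    rw [← ih, ← hone (fun k => P (k + i)) (hPj i)]
    simp only [add_assoc, add_comm (1 : ℤ)]
  | pred i ih =>
    rw [← ih, ← hone (fun k => P (k + (-i - 1))) (hPj _)]
    have e : ∀ k : ℤ, k + 1 + (-i - 1) = k + -i := fun k => by ring
    simp only [e]

open Classical in
theorem empiricalDistribution_eq (L : ℝ) (N : ℕ) (x : ℤ → ℝ → ℝ) (t y : ℝ) :
    empiricalDistribution L N x t y
      = (((Finset.range N).filter fun k : ℕ => circleProj L (x k t) ≤ y).card : ℝ) / N := by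
  rw [empiricalDistribution]
  congr 2
  rw [Nat.card_eq_fintype_card, Fintype.card_subtype]
  refine Finset.card_bij (fun k _ => (k : ℕ)) (fun k hk => ?_) (fun a _ b _ hab => Fin.ext hab)
    fun k hk => ?_
  · simp only [Finset.mem_filter, Finset.mem_univ, true_and] at hk
    exact Finset.mem_filter.2 ⟨Finset.mem_range.2 k.2, hk⟩
  · rw [Finset.mem_filter, Finset.mem_range] at hk
    exact ⟨⟨k, hk.1⟩, by simpa using hk.2, rfl⟩

theorem circleProj_add {L : ℝ} (hL : 0 < L) (s : ℝ) : circleProj L (s + L) = circleProj L s := by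
  rw [circleProj, circleProj, add_div, div_self hL.ne', Int.fract_add_one]

theorem circleProj_of_mem {L s : ℝ} (hs : s ∈ Ico 0 L) : circleProj L s = s := by
  have hL : 0 < L := hs.1.trans_lt hs.2
  rw [circleProj, Int.fract_eq_self.2 ⟨div_nonneg hs.1 hL.le, (div_lt_one hL).2 hs.2⟩]
  field_simp

end Counting

/-! ### Limits of the trajectories and of the empirical distributions -/

namespace IsContinuumLimit

variable {L ω α v θ K : ℝ} {f X V : ℝ → ℝ} {Φ Φt Φs Φtt Φts Φss : ℝ → ℝ → ℝ}
  (h : IsContinuumLimit L ω α v θ K f X V Φ Φt Φs Φtt Φts Φss)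

include h

/-- `Φ 0` has slope at least `1 - θ`: a label off by more than `η` would displace the position by
more than the allowed error `(1 - θ) * η`. The extra `L / N` is the gap to the next particle. -/
theorem abs_label_sub_le_of_gap (hL : 0 < L) {N : ℕ} {q : ℤ → ℝ} {η a : ℝ} {k : ℤ} (hθ : θ < 1)
    (hq : ∀ k : ℤ, |q k - Φ 0 (k * L / N)| ≤ (1 - θ) * η) (hk : q k ≤ a) (hk' : a < q (k + 1)) :
    |k * L / N - label Φ 0 a| ≤ η + L / N := by
  have hθ' : 0 < 1 - θ := sub_pos.2 hθ
  have hη : 0 ≤ η := nonneg_of_mul_nonneg_right ((abs_nonneg _).trans (hq 0)) hθ'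
  set σ := label Φ 0 a with hσ
  have hΦσ : Φ 0 σ = a := h.apply_label hθ le_rfl a
  have e1 : ((k + 1 : ℤ) : ℝ) * L / N = k * L / N + L / N := by push_cast; ring
  have h1 := (abs_le.1 (hq k)).1
  have h2 := (abs_le.1 (hq (k + 1))).2
  rw [e1] at h2
  have hup : k * L / N ≤ σ + η := by
    by_contra hcon
    rw [not_le] at hcon
    have h3 := h.le_sub le_rfl (by linarith : σ ≤ k * L / N)
    nlinarith
  have hlo : σ - η ≤ k * L / N + L / N := by
    by_contra hcon
    rw [not_le] at hcon
    have h3 := h.le_sub le_rfl (by linarith : k * L / N + L / N ≤ σ)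
    nlinarith
  have hLN : 0 ≤ L / N := by positivity
  exact abs_le.2 ⟨by linarith, by linarith⟩

omit h in
theorem eventually_div_le (L : ℝ) {ε : ℝ} (hε : 0 < ε) : ∀ᶠ N : ℕ in atTop, L / (N : ℝ) ≤ ε :=
  (tendsto_const_div_atTop_nhds_zero_nat L).eventually (ge_mem_nhds hε)

theorem isLimitFlow (hL : 0 < L) (hθ : θ < 1) {ω' : ℕ → ℝ} {x w : ℕ → ℤ → ℝ → ℝ}
    (hchain : ∀ᶠ N : ℕ in atTop, IsChain L (ω' N) α f N (x N) (w N))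
    (hconv : ∀ T ε : ℝ, 0 < ε → ∀ᶠ N : ℕ in atTop, ∀ k : ℤ, ∀ t ∈ Icc 0 T,
      |x N k t - Φ t (k * L / N)| ≤ ε) :
    IsLimitFlow x fun t a => Φ t (label Φ 0 a) := by
  intro T hT
  rw [Metric.tendstoUniformlyOn_iff]
  intro ε hε
  have hθ' : 0 < 1 - θ := sub_pos.2 hθ
  -- Total error: `ε/8` from the chain, plus the Lipschitz constant `2` times a label error of `ε/8
  -- + ε/8`.
  filter_upwards [hchain, hconv T (min (ε / 8) ((1 - θ) * (ε / 8))) (by positivity),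
    eventually_div_le L (by positivity : 0 < ε / 8)] with N hN hx hLN
  rintro ⟨t, a⟩ ⟨ht, -⟩
  obtain ⟨h1, h2⟩ := particleIndex_spec hL hN.ordered (fun k => hN.periodic k 0 le_rfl) a
  set k := particleIndex (fun k => x N k 0) a with hk
  have h3 := h.abs_label_sub_le_of_gap hL (q := fun k => x N k 0) hθ
    (fun k => (hx k 0 (left_mem_Icc.2 hT.le)).trans (min_le_right _ _)) h1 h2
  have h4 := h.abs_sub_le hθ ht.1 (k * L / N) (label Φ 0 a)
  have h5 := (hx k t ht).trans (min_le_left _ _)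
  rw [dist_comm, Real.dist_eq]
  have h6 := _root_.abs_sub_le (x N k t) (Φ t (k * L / N)) (Φ t (label Φ 0 a))
  dsimp only at h4 ⊢
  linarith

-- Particles with label in `[σ + η, τ - η]` certainly lie in `[0, y]`, those with label in `(τ + η,
-- σ + L - η)` certainly do not, where `σ`, `τ` are the labels of `0`, `y`. Only particles near the
-- ends stay undecided; the additive `2` pays for the rounding at both ends.
open Classical in
theorem abs_card_sub_le (hL : 0 < L) (hθ : θ < 1) {N : ℕ} (hN : 0 < N) {q : ℤ → ℝ} {t y η : ℝ}
    (ht : 0 ≤ t) (hy : y ∈ Ico 0 L) (hη : 0 ≤ η) (hper : ∀ k, q (k + N) = q k + L)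
    (hq : ∀ k : ℤ, |q k - Φ t (k * L / N)| ≤ (1 - θ) * η) :
    |(((Finset.range N).filter fun k : ℕ => circleProj L (q k) ≤ y).card : ℝ)
      - (label Φ t y - label Φ t 0) / (L / N)| ≤ 2 * (η / (L / N)) + 2 := by
  have hθ' : 0 < 1 - θ := sub_pos.2 hθ
  have hN' : (0 : ℝ) < N := by exact_mod_cast hN
  set d := L / N with hd
  have hd0 : 0 < d := by positivity
  have hNd : (N : ℝ) * d = L := by rw [hd]; field_simp
  set σ := label Φ t 0 with hσ
  set τ := label Φ t y with hτ
  have hΦσ : Φ t σ = 0 := h.apply_label hθ ht 0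
  have hΦτ : Φ t τ = y := h.apply_label hθ ht y
  have hστ : σ ≤ τ := (h.label_strictMono hθ ht).monotone hy.1
  have hτL : τ < σ + L := by
    rw [hσ, ← h.label_add hθ ht, zero_add]
    exact h.label_strictMono hθ ht hy.2
  -- Starting the window at `j` makes the labels `(k + j) * d` run once through a period that begins
  -- in `[σ, σ + d)`.
  set j := ⌈σ / d⌉ with hj
  have hj1 : σ ≤ j * d := (div_le_iff₀ hd0).1 (Int.le_ceil _)
  have hj2 : j * d < σ + d := by
    have := (lt_div_iff₀ hd0).1 (sub_lt_iff_lt_add.2 (Int.ceil_lt_add_one (σ / d)))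
    rw [sub_mul, one_mul] at this
    linarith
  have hs : ∀ k : ℕ, (((k : ℤ) + j : ℤ) : ℝ) * L / N = k * d + j * d := fun k => by
    rw [hd]; push_cast; ring
  rw [← card_filter_shift (P := fun k => circleProj L (q k) ≤ y)
    (fun k => by rw [hper, circleProj_add hL]) j]
  set A := (Finset.range N).filter fun k : ℕ => circleProj L (q (k + j)) ≤ y with hA
  set A' := (Finset.range N).filter fun k : ℕ => ¬circleProj L (q (k + j)) ≤ y with hA'
  have hAA' : (A.card : ℝ) + A'.card = N := by
    have := Finset.card_filter_add_card_filter_not (s := Finset.range N)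
      (fun k : ℕ => circleProj L (q (k + j)) ≤ y)
    rw [Finset.card_range] at this
    exact_mod_cast this
  have hqk : ∀ k : ℕ, |q (k + j) - Φ t (k * d + j * d)| ≤ (1 - θ) * η := fun k => by
    rw [← hs]; exact hq _
  have hin : ∀ k : ℕ, σ + η ≤ k * d + j * d → k * d + j * d ≤ τ - η →
      circleProj L (q (k + j)) ≤ y := fun k h1 h2 => by
    have h3 := h.le_sub ht (by linarith : σ ≤ k * d + j * d)
    have h4 := h.le_sub ht (by linarith : k * d + j * d ≤ τ)
    have h5 := abs_le.1 (hqk k)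
    have h6 : (1 - θ) * η ≤ (1 - θ) * (k * d + j * d - σ) := by gcongr; linarith
    have h7 : (1 - θ) * η ≤ (1 - θ) * (τ - (k * d + j * d)) := by gcongr; linarith
    have h8 : q (k + j) ≤ y := by linarith
    rwa [circleProj_of_mem ⟨by linarith, h8.trans_lt hy.2⟩]
  have hout : ∀ k : ℕ, τ + η < k * d + j * d → k * d + j * d < σ + L - η →
      ¬circleProj L (q (k + j)) ≤ y := fun k h1 h2 => by
    have h3 := h.le_sub ht (by linarith : τ ≤ k * d + j * d)
    have h4 := h.le_sub ht (by linarith : k * d + j * d ≤ σ + L)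
    rw [h.shift] at h4
    have h5 := abs_le.1 (hqk k)
    have h6 : (1 - θ) * η < (1 - θ) * (k * d + j * d - τ) := by gcongr; linarith
    have h7 : (1 - θ) * η < (1 - θ) * (σ + L - (k * d + j * d)) := by gcongr; linarith
    have h8 : y < q (k + j) := by linarith
    rw [circleProj_of_mem ⟨hy.1.trans h8.le, by linarith⟩]
    exact not_le.2 h8
  have hA1 : A ⊆ ((Finset.range N).filter fun k : ℕ => (k : ℝ) ≤ (τ - σ + η) / d) ∪
      (Finset.range N).filter fun k : ℕ => (L - η - d) / d ≤ (k : ℝ) := fun k hk => by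
    rw [hA, Finset.mem_filter] at hk
    rw [Finset.mem_union, Finset.mem_filter, Finset.mem_filter, le_div_iff₀ hd0, div_le_iff₀ hd0]
    by_contra! hcon
    have h1 := hcon.1 hk.1
    have h2 := hcon.2 hk.1
    exact hout k (by linarith) (by linarith) hk.2
  have hA2 : A' ⊆ ((Finset.range N).filter fun k : ℕ => (k : ℝ) ≤ η / d) ∪
      (Finset.range N).filter fun k : ℕ => (τ - σ - η - d) / d ≤ (k : ℝ) := fun k hk => by
    rw [hA', Finset.mem_filter] at hk
    rw [Finset.mem_union, Finset.mem_filter, Finset.mem_filter, le_div_iff₀ hd0, div_le_iff₀ hd0]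
    by_contra! hcon
    have h1 := hcon.1 hk.1
    have h2 := hcon.2 hk.1
    exact hk.2 (hin k (by linarith) (by linarith))
  have hc : ∀ {A B C : Finset ℕ}, A ⊆ B ∪ C → (A.card : ℝ) ≤ B.card + C.card := fun hs => by
    exact_mod_cast (Finset.card_le_card hs).trans (Finset.card_union_le _ _)
  have b1 := card_filter_le_le (N := N) (B := (τ - σ + η) / d) (div_nonneg (by linarith) hd0.le)
  have b2 := card_filter_ge_le (N := N) (B := (L - η - d) / d)
    ((div_le_iff₀ hd0).2 (by rw [hNd]; linarith))
  have b3 := card_filter_le_le (N := N) (B := η / d) (div_nonneg hη hd0.le)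
  have b4 := card_filter_ge_le (N := N) (B := (τ - σ - η - d) / d)
    ((div_le_iff₀ hd0).2 (by rw [hNd]; linarith))
  have hLd : L / d = N := by rw [← hNd]; field_simp
  have hdd : d / d = 1 := div_self hd0.ne'
  have u1 := (hc hA1).trans (add_le_add b1 b2)
  have u2 := (hc hA2).trans (add_le_add b3 b4)
  simp only [add_div, sub_div, hLd, hdd] at u1 u2 ⊢
  exact abs_le.2 ⟨by linarith, by linarith⟩

theorem isLimitDistribution (hL : 0 < L) (hθ : θ < 1) {ω' : ℕ → ℝ} {x w : ℕ → ℤ → ℝ → ℝ}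
    (hchain : ∀ᶠ N : ℕ in atTop, IsChain L (ω' N) α f N (x N) (w N))
    (hconv : ∀ T ε : ℝ, 0 < ε → ∀ᶠ N : ℕ in atTop, ∀ k : ℤ, ∀ t ∈ Icc 0 T,
      |x N k t - Φ t (k * L / N)| ≤ ε) :
    IsLimitDistribution L x fun t y => (label Φ t y - label Φ t 0) / L := by
  intro T hT
  rw [Metric.tendstoUniformlyOn_iff]
  intro ε hε
  have hθ' : 0 < 1 - θ := sub_pos.2 hθ
  -- With `η = ε L / 8` the counting error divided by `N` is at most `ε/4 + 2/N`, and `2/N ≤ ε/4`.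
  filter_upwards [hchain, hconv T ((1 - θ) * (ε * L / 8)) (by positivity),
    eventually_div_le 1 (by positivity : 0 < ε / 8), eventually_gt_atTop 0] with N hN hx hLN hN0
  rintro ⟨t, y⟩ ⟨ht, hy⟩
  have hN' : (0 : ℝ) < N := by exact_mod_cast hN0
  have h1 := h.abs_card_sub_le hL hθ hN0 ht.1 hy (by positivity : 0 ≤ ε * L / 8)
    (fun k => hN.periodic k t ht.1) (fun k => hx k t ht)
  rw [dist_comm, Real.dist_eq]
  simp only
  rw [empiricalDistribution_eq]
  have e : ∀ c : ℝ, c / N - (label Φ t y - label Φ t 0) / L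
      = (c - (label Φ t y - label Φ t 0) / (L / N)) / N := fun c => by field_simp
  rw [e, abs_div, abs_of_pos hN', div_lt_iff₀ hN']
  refine h1.trans_lt ?_
  have h2 : ε * L / 8 / (L / N) = ε / 8 * N := by field_simp
  rw [div_le_iff₀ hN'] at hLN
  rw [h2]
  nlinarith

end IsContinuumLimit
end ClosedString

theorem mainTheorem3
    (L ω₀ ω₁ α C₁ C₂ δ v : ℝ) (hL : 0 < L) (hω₀ : 0 < ω₀) (hω₁ : ω₁ = ω₀ * L) (hα : 0 ≤ α)
    (hC₁ : 0 < C₁) (hC₂ : 0 < C₂) (hδ₀ : 0 < δ) (hδ₁ : δ < 1)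
    (f : ℝ → ℝ) (hf : ContDiff ℝ 2 f)
    (X V : ℝ → ℝ) (hXV : ClosedString.IsProfile L X V)
    (hγ : ClosedString.gammaConst L ω₀ α C₁ C₂ X V < δ)
    (x w : ℕ → ℤ → ℝ → ℝ)
    (hchain : ∀ᶠ N : ℕ in Filter.atTop,
      ClosedString.IsChain L (ω₀ * N) α f N (x N) (w N))
    (hinit : ∀ᶠ N : ℕ in Filter.atTop,
      ClosedString.FollowsProfile L X V C₁ C₂ N (x N) (w N))
    (hv : Filter.Tendsto (fun N : ℕ => w N 0 0) Filter.atTop (nhds v)) :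
    ∃ Y F n u : ℝ → ℝ → ℝ,
      ClosedString.IsLimitFlow x Y ∧
      ClosedString.IsLimitDistribution L x F ∧
      ClosedString.IsDensity L F n ∧
      ClosedString.IsVelocityField L Y u ∧
      ClosedString.SolvesEuler ω₁ α f (fun t y => L * n t y) u ∧
      ClosedString.SolvesEuler ω₀ α f n u := by
  obtain ⟨K, Φ, Φt, Φs, Φtt, Φts, Φss, hΦ⟩ := ClosedString.exists_isContinuumLimit (v := v) hL hω₀
    hω₁ hα hC₁ hC₂ hf.continuous hXV hγ
  have hconv := fun T ε (hε : 0 < ε) => ClosedString.eventually_abs_chain_sub_le hL hω₀ hω₁ hα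
    hC₁ hC₂ hXV hΦ hchain hinit hv T hε
  have hρ : (fun t y => L * (L⁻¹ / Φs t (ClosedString.label Φ t y)))
      = fun t y => 1 / Φs t (ClosedString.label Φ t y) := by
    funext t y
    rw [← mul_div_assoc, mul_inv_cancel₀ hL.ne']
  refine ⟨_, _, _, _, hΦ.isLimitFlow hL hδ₁ hchain hconv,
    hΦ.isLimitDistribution hL hδ₁ hchain hconv, hΦ.isDensity hδ₁, hΦ.isVelocityField hδ₁, ?_,
    hΦ.solvesEuler hδ₁ (inv_pos.2 hL) (by rw [hω₁]; field_simp)⟩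
  rw [hρ]
  exact hΦ.solvesEuler hδ₁ one_pos (mul_one ω₁).symm
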